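/- Let $X$ be a compact metric space with metric $d$, without isolated points and with $|X|=\mathfrak c$, and let $f:X\to X$ be a transitive homeomorphism, i.e. some point of $X$ has a dense two-sided orbit $\{f^k(x):k\in\mathbb Z\}$. For $\varepsilon>0$, an $\varepsilon$-chain from $x$ to $y$ is a finite sequence $C: x=x_0,x_1,\dots,x_m=y$ with $m\ge 1$ and $d(f(x_i),x_{i+1})<\varepsilon$ for $0\le i<m$; $\widehat C=\{x_0,\dots,x_m\}$ is its support. It is acyclic if the interior points $x_1,\dots,x_{m-1}$ are pairwise distinct and different from $x_0$ and $x_m$. An order-compatible nested sequence from $x$ to $y$ is a sequence $(C_n)_{n\in\mathbb N}$ of acyclic $\varepsilon_n$-chains from $x$ to $y$, for some positive $\varepsilon_n$ decreasing monotonically to $0$, such that $\widehat{C_n}\subseteq\widehat{C_{n+1}}$ for all $n$ and such that, for all $z,w\in\widehat{C_n}\setminus\{x,y\}$, if $z$ appears no later than $w$ in $C_n$ (comparing first occurrences), then $z$ appears no later than $w$ in $C_{n+1}$. Its limit order is the set $\bigcup_n\widehat{C_n}\setminus\{x,y\}$, linearly ordered by: $z\le_\infty w$ iff $z=w$ or $z$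 appears no later than $w$ in every $C_n$ whose support contains both. The Emergent Order Spectrum $\Omega(x,y)$ is the set of the order-types of the limit orders of all order-compatible nested sequences from $x$ to $y$, and $\Omega(X^2)=\bigcup_{(x,y)\in X^2}\Omega(x,y)$ is the global spectrum. A linear order is scattered if it has no subset order-isomorphic to $\mathbb Q$; $\eta$ denotes the order-type of $\mathbb Q$. Then every countable (finite or infinite) scattered order-type, and also $\eta$, belongs to $\Omega(X^2)$. More precisely: 1. there is a comeagre set $\mathcal M\subseteq X^2$ such that for every $(x,y)\in\mathcal M$, $\Omega(x,y)$ contains every countably infinite scattered order-type; 2. for all $x,y\in X$, $\Omega(x,y)$ contains the order-type of some finite ordinal $K\in\{0,1,2,\dots\}$ if and only if $y\in\mathcal O^+(x)=\{f^k(x):k\ge 1\}$; 3. $\eta\in\Omega(x,y)$ for all $x,y\in X$. -/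

import Mathlib

universe u

/-- The two-sided orbit of `x` under a homeomorphism. -/
def twoSidedOrbit {X : Type u} [TopologicalSpace X] (f : X ≃ₜ X) (x : X) : Set X :=
  {y | ∃ k : ℤ, y = (f ^ k) x}

/-- The forward orbit `{f^k(x) : k ≥ 1}`; the point `x` itself is only included if it is
periodic. -/
def forwardOrbit {X : Type u} (f : X → X) (x : X) : Set X :=
  {y | ∃ k : ℕ, 0 < k ∧ y = f^[k] x}

/-- A homeomorphism is transitive if some point has a dense (two-sided) orbit. -/
def IsTransitiveHomeo {X : Type u} [TopologicalSpace X] (f : X ≃ₜ X) : Prop :=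
  ∃ x : X, Dense (twoSidedOrbit f x)

/-- A linear order is scattered if no subset of it is order-isomorphic to `ℚ`. -/
def IsScatteredOrder (L : Type u) [LinearOrder L] : Prop :=
  ∀ S : Set L, IsEmpty (ℚ ≃o S)

/-- An `ε`-chain from `x` to `y`: a map `{0, …, m} → X` with `m ≥ 1`. -/
structure EpsChain {X : Type u} [MetricSpace X] (f : X → X) (ε : ℝ) (x y : X) where
  len : ℕ
  len_pos : 0 < len
  pt : Fin (len + 1) → X
  first : pt 0 = x
  last : pt (Fin.last len) = y
  step : ∀ i : Fin len, dist (f (pt i.castSucc)) (pt i.succ) < ε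

namespace EpsChain

variable {X : Type u} [MetricSpace X] {f : X → X} {ε : ℝ} {x y : X}

/-- The set of points of the chain. -/
def support (C : EpsChain f ε x y) : Set X := Set.range C.pt

/-- No interior point is repeated, and no interior point equals an end point. (The two end points
may coincide with each other.) -/
def IsAcyclic (C : EpsChain f ε x y) : Prop :=
  (∀ i j : Fin (C.len + 1), i ≠ 0 → i ≠ Fin.last C.len → j ≠ 0 → j ≠ Fin.last C.len →
    i ≠ j → C.pt i ≠ C.pt j) ∧
  (∀ i : Fin (C.len + 1), i ≠ 0 → i ≠ Fin.last C.len →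
    C.pt i ≠ C.pt 0 ∧ C.pt i ≠ C.pt (Fin.last C.len))

/-- The least index at which `z` occurs in the chain (only meaningful for `z` in the support). -/
noncomputable def firstIndex (C : EpsChain f ε x y) (z : X) : ℕ :=
  sInf {i : ℕ | ∃ h : i < C.len + 1, C.pt ⟨i, h⟩ = z}

/-- `z` appears no later than `w` in the chain (used only for `z`, `w` in the support). -/
def NoLater (C : EpsChain f ε x y) (z w : X) : Prop := C.firstIndex z ≤ C.firstIndex w

theorem firstIndex_spec (C : EpsChain f ε x y) {z : X} (hz : z ∈ C.support) :
    ∃ h : C.firstIndex z < C.len + 1, C.pt ⟨C.firstIndex z, h⟩ = z := by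
  have hne : {i : ℕ | ∃ h : i < C.len + 1, C.pt ⟨i, h⟩ = z}.Nonempty := by
    obtain ⟨i, hi⟩ := hz
    exact ⟨i.1, i.2, hi⟩
  exact Nat.sInf_mem hne

theorem firstIndex_inj (C : EpsChain f ε x y) {z w : X} (hz : z ∈ C.support)
    (hw : w ∈ C.support) (h : C.firstIndex z = C.firstIndex w) : z = w := by
  obtain ⟨h1, e1⟩ := C.firstIndex_spec hz
  obtain ⟨h2, e2⟩ := C.firstIndex_spec hw
  rw [← e1, ← e2]
  congr 1
  exact Fin.ext h

end EpsChain

/-- An order-compatible nested sequence of acyclic `ε n`-chains from `x` to `y`, where `ε n > 0`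
tends monotonically to `0`. -/
structure OrderCompatibleSeq {X : Type u} [MetricSpace X] (f : X → X) (x y : X) where
  ε : ℕ → ℝ
  ε_pos : ∀ n, 0 < ε n
  ε_anti : Antitone ε
  ε_lim : Filter.Tendsto ε Filter.atTop (nhds 0)
  chain : ∀ n, EpsChain f (ε n) x y
  acyclic : ∀ n, (chain n).IsAcyclic
  nested : ∀ n, (chain n).support ⊆ (chain (n + 1)).support
  compat : ∀ n, ∀ z ∈ (chain n).support \ {x, y}, ∀ w ∈ (chain n).support \ {x, y},
    (chain n).NoLater z w → (chain (n + 1)).NoLater z w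

namespace OrderCompatibleSeq

variable {X : Type u} [MetricSpace X] {f : X → X} {x y : X}

/-- All points of all the chains, except the two end points. -/
def limitSet (S : OrderCompatibleSeq f x y) : Set X :=
  (⋃ n, (S.chain n).support) \ {x, y}

/-- The limit set as a type, carrying the limit order `≤_∞` (see the instance below). -/
def Limit (S : OrderCompatibleSeq f x y) : Type u := {z : X // z ∈ S.limitSet}

/-- The limit relation `≤_∞`. -/
def limitLE (S : OrderCompatibleSeq f x y) (z w : X) : Prop :=
  z = w ∨ ∀ n, z ∈ (S.chain n).support → w ∈ (S.chain n).support → (S.chain n).NoLater z w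

theorem support_mono (S : OrderCompatibleSeq f x y) :
    Monotone fun n => (S.chain n).support :=
  monotone_nat_of_le_succ S.nested

theorem noLater_mono (S : OrderCompatibleSeq f x y) {z w : X} {n m : ℕ} (hnm : n ≤ m)
    (hz : z ∈ (S.chain n).support \ {x, y}) (hw : w ∈ (S.chain n).support \ {x, y})
    (h : (S.chain n).NoLater z w) : (S.chain m).NoLater z w := by
  induction m, hnm using Nat.le_induction with
  | base => exact h
  | succ m hm ih =>
    exact S.compat m z ⟨S.support_mono hm hz.1, hz.2⟩ w ⟨S.support_mono hm hw.1, hw.2⟩ ih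

theorem noLater_iff (S : OrderCompatibleSeq f x y) {z w : X} {n m : ℕ} (hnm : n ≤ m)
    (hz : z ∈ (S.chain n).support \ {x, y}) (hw : w ∈ (S.chain n).support \ {x, y}) :
    (S.chain n).NoLater z w ↔ (S.chain m).NoLater z w := by
  refine ⟨S.noLater_mono hnm hz hw, fun h => ?_⟩
  rcases Nat.le_total ((S.chain n).firstIndex z) ((S.chain n).firstIndex w) with h1 | h1
  · exact h1
  · have h2 : (S.chain m).NoLater w z := S.noLater_mono hnm hw hz h1
    have h3 : z = w := (S.chain m).firstIndex_inj (S.support_mono hnm hz.1)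
      (S.support_mono hnm hw.1) (le_antisymm h h2)
    subst h3
    exact le_refl _

theorem limitLE_iff (S : OrderCompatibleSeq f x y) {z w : X} {n : ℕ}
    (hz : z ∈ (S.chain n).support \ {x, y}) (hw : w ∈ (S.chain n).support \ {x, y}) :
    S.limitLE z w ↔ (S.chain n).NoLater z w := by
  constructor
  · rintro (h | h)
    · subst h
      exact le_refl _
    · exact h n hz.1 hw.1
  · intro h
    refine Or.inr fun m hzm hwm => ?_
    rcases Nat.le_total n m with hnm | hnm
    · exact (S.noLater_iff hnm hz hw).1 h
    · exact (S.noLater_iff hnm ⟨hzm, hz.2⟩ ⟨hwm, hw.2⟩).2 h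

theorem exists_common (S : OrderCompatibleSeq f x y) (a b c : S.Limit) :
    ∃ n, a.1 ∈ (S.chain n).support \ {x, y} ∧ b.1 ∈ (S.chain n).support \ {x, y} ∧
      c.1 ∈ (S.chain n).support \ {x, y} := by
  obtain ⟨i, hi⟩ := Set.mem_iUnion.1 a.2.1
  obtain ⟨j, hj⟩ := Set.mem_iUnion.1 b.2.1
  obtain ⟨k, hk⟩ := Set.mem_iUnion.1 c.2.1
  refine ⟨max i (max j k), ⟨S.support_mono ?_ hi, a.2.2⟩, ⟨S.support_mono ?_ hj, b.2.2⟩,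
    ⟨S.support_mono ?_ hk, c.2.2⟩⟩ <;> simp

/-- The limit set, linearly ordered by `≤_∞`. -/
noncomputable instance instLinearOrderLimit (S : OrderCompatibleSeq f x y) :
    LinearOrder S.Limit where
  le a b := S.limitLE a.1 b.1
  le_refl _ := Or.inl rfl
  le_trans a b c hab hbc := by
    obtain ⟨n, ha, hb, hc⟩ := S.exists_common a b c
    exact (S.limitLE_iff ha hc).2
      (le_trans ((S.limitLE_iff ha hb).1 hab) ((S.limitLE_iff hb hc).1 hbc))
  le_antisymm a b hab hba := by
    obtain ⟨n, ha, hb, _⟩ := S.exists_common a b b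
    exact Subtype.ext ((S.chain n).firstIndex_inj ha.1 hb.1
      (le_antisymm ((S.limitLE_iff ha hb).1 hab) ((S.limitLE_iff hb ha).1 hba)))
  le_total a b := by
    obtain ⟨n, ha, hb, _⟩ := S.exists_common a b b
    rcases Nat.le_total ((S.chain n).firstIndex a.1) ((S.chain n).firstIndex b.1) with h | h
    · exact Or.inl ((S.limitLE_iff ha hb).2 h)
    · exact Or.inr ((S.limitLE_iff hb ha).2 h)
  toDecidableLE := Classical.decRel _

end OrderCompatibleSeq

/-- The Emergent Order Spectrum `Ω_f(x, y)`: the order-types of the limit orders of all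
order-compatible nested sequences from `x` to `y`. -/
def emergentOrderSpectrum {X : Type u} [MetricSpace X] (f : X → X) (x y : X) :
    Set OrderType.{u} :=
  {o | ∃ S : OrderCompatibleSeq f x y, o = OrderType.type S.Limit}

/-- The global spectrum `Ω_f(X²)`: the order-types that occur in some `Ω_f(x, y)`. -/
def globalOrderSpectrum {X : Type u} [MetricSpace X] (f : X → X) : Set OrderType.{u} :=
  ⋃ p : X × X, emergentOrderSpectrum f p.1 p.2

/-- The order-type of the finite linear order on `K` elements. -/
noncomputable def finiteOrderType (K : ℕ) : OrderType.{u} :=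
  OrderType.lift.{u} (OrderType.type (Fin K))

/-- The order-type `η` of the rationals. -/
noncomputable def etaOrderType : OrderType.{u} :=
  OrderType.lift.{u} (OrderType.type ℚ)

-- Everything rests on a realization principle, `exists_orderCompatibleSeq`. Let `L` be a countable
-- order with end points and let `p : L → X` be injective, except that `p ⊥ = p ⊤` is allowed.
-- Suppose that at every scale `ε` any `a ≤ b` are joined by a finite increasing sequence whose
-- image is an `ε`-chain. Exhausting `L` by finite sets with `ε n`-related consecutive elements
-- gives nested chains. They are order-compatible because each inherits its order from `L`, and the
-- limit order is the open interval between the end points. It remains to adjoin two end points to a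
-- given order and to find `p`.
--
-- For infinite types `p` comes from the diagonal argument `exists_forall_of_finite_support`: "join
-- `a` to `b` at scale `1/(n+1)`" involves finitely many coordinates, so it suffices to achieve it
-- while finitely many coordinates stay frozen. For a dense order this is easy: by Baire some point
-- near `f (p a)` has a dense forward orbit that misses all points in use, and a finite segment of
-- it leading to `p b` fits on unused places between `a` and `b`.
--
-- In a scattered order there is no room inside a covering pair, so such a pair must be an exact
-- step of `f`. Each block of the finite condensation then follows one orbit, with one free base
-- point per block; the base points of the blocks of `⊥` and `⊤` are `x` and `y`. A cut that is not
-- a jump is crossed either by steering a free block to the target, or, if only frozen blocks are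
-- available, by a dense half orbit inside one of them. Hence `x` and `y` should have dense half
-- orbits and lie on distinct orbits, which is generic. If joining failed for some pair, a
-- condensation argument (`rel_of_isEmpty_rat_embedding`) would produce a copy of `ℚ`.
--
-- A finite limit order leaves only finitely many distances, so fine chains are true orbit segments;
-- conversely a shortest orbit segment is acyclic.

universe v

open Filter Topology

/-! ### Generic points of a transitive homeomorphism -/

section Dynamics

variable {X : Type u} [MetricSpace X] {f : X ≃ₜ X}

/-- Both the forward and the backward orbit of `x` are dense. -/
def HasDenseHalfOrbits (f : X ≃ₜ X) (x : X) : Prop :=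
  Dense (Set.range fun n : ℕ => (f ^ (n : ℤ)) x) ∧
    Dense (Set.range fun n : ℕ => (f ^ (-(n : ℤ))) x)

theorem zpow_add_apply (f : X ≃ₜ X) (i j : ℤ) (x : X) : (f ^ (i + j)) x = (f ^ i) ((f ^ j) x) := by
  rw [zpow_add]; rfl

theorem zpow_one_add_apply (f : X ≃ₜ X) (j : ℤ) (x : X) : (f ^ (j + 1)) x = f ((f ^ j) x) := by
  rw [add_comm, zpow_add_apply, zpow_one]

theorem iterate_eq_zpow (f : X ≃ₜ X) (n : ℕ) (x : X) : (f^[n]) x = (f ^ (n : ℤ)) x := by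
  induction n with
  | zero => rfl
  | succ n ih => rw [Function.iterate_succ_apply', ih]; push_cast; rw [zpow_one_add_apply]

theorem zpow_apply_eq_iff (f : X ≃ₜ X) (i j : ℤ) (x y : X) :
    (f ^ i) x = (f ^ j) y ↔ x = (f ^ (j - i)) y := by
  constructor
  · intro h
    rw [sub_eq_neg_add, zpow_add_apply, ← h, ← zpow_add_apply]; simp
  · rintro rfl
    rw [← zpow_add_apply]; congr 2; ring

theorem exists_sub_ge_of_infinite {S : Set ℤ} (hS : S.Infinite) (N : ℤ) :
    ∃ i ∈ S, ∃ j ∈ S, N ≤ i - j := by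
  by_contra! h
  obtain ⟨s, hs⟩ := hS.nonempty
  refine hS ((Set.finite_Icc (s - N) (s + N)).subset fun t ht => ⟨?_, ?_⟩)
  · have := h s hs t ht; linarith
  · have := h t ht s hs; linarith

/-- Without isolated points, a dense set stays dense after finitely many points are removed. -/
theorem infinite_visits (hiso : ∀ x : X, ¬ IsOpen ({x} : Set X)) {x : X}
    (hx : Dense (twoSidedOrbit f x)) {W : Set X} (hW : IsOpen W) (hne : W.Nonempty) :
    {i : ℤ | (f ^ i) x ∈ W}.Infinite := by
  intro hfin
  have : ∀ x : X, NeBot (𝓝[≠] x) := fun x =>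
    ⟨fun h => hiso x ((isOpen_singleton_iff_punctured_nhds x).2 h)⟩
  have hd := hx.sdiff_finite (hfin.image fun i => (f ^ i) x)
  obtain ⟨y, hyW, ⟨k, rfl⟩, hy⟩ := hd.inter_open_nonempty W hW hne
  exact hy ⟨k, hyW, rfl⟩

/-- Turns a dense two-sided orbit into forward transitivity. If the orbit is in `V` at time `i` and
in `U` at time `j`, then it meets `V ∩ (f ^ (j - i)) ⁻¹' U` at infinitely many times. Two of these,
`a` and `b`, with `a - b ≥ |j - i|` make the travel time `a + (j - i) - b` nonnegative. -/
theorem exists_visit (hiso : ∀ x : X, ¬ IsOpen ({x} : Set X)) (hf : IsTransitiveHomeo f)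
    {U V : Set X} (hU : IsOpen U) (hV : IsOpen V) (hUne : U.Nonempty) (hVne : V.Nonempty) :
    ∃ n : ℕ, ∃ v ∈ V, (f ^ (n : ℤ)) v ∈ U := by
  obtain ⟨x, hx⟩ := hf
  obtain ⟨i, hi⟩ := (infinite_visits hiso hx hV hVne).nonempty
  obtain ⟨j, hj⟩ := (infinite_visits hiso hx hU hUne).nonempty
  have hWo : IsOpen (V ∩ (f ^ (j - i)) ⁻¹' U) := hV.inter (hU.preimage (f ^ (j - i)).continuous)
  have hWne : (V ∩ (f ^ (j - i)) ⁻¹' U).Nonempty := by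
    refine ⟨(f ^ i) x, hi, ?_⟩
    simpa [← zpow_add_apply] using hj
  obtain ⟨a, ha, b, hb, hab⟩ :=
    exists_sub_ge_of_infinite (infinite_visits hiso hx hWo hWne) |j - i|
  have h1 : 0 ≤ a + (j - i) - b := by
    have := neg_abs_le (j - i)
    linarith
  obtain ⟨n, hn⟩ := Int.eq_ofNat_of_zero_le h1
  refine ⟨n, (f ^ b) x, hb.1, ?_⟩
  have h2 : (f ^ (j - i)) ((f ^ a) x) ∈ U := ha.2
  rw [← zpow_add_apply] at h2 ⊢
  convert h2 using 3
  omega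

/-- The Birkhoff transitivity argument: for each basic open `U`, the points that some `g n` sends
into `U` form a dense open set. -/
theorem residual_dense_range [SecondCountableTopology X] (g : ℕ → X → X)
    (hg : ∀ n, Continuous (g n))
    (h : ∀ U V : Set X, IsOpen U → IsOpen V → U.Nonempty → V.Nonempty →
      ∃ n, ∃ v ∈ V, g n v ∈ U) :
    ∀ᶠ x in residual X, Dense (Set.range fun n => g n x) := by
  have key : ∀ U ∈ TopologicalSpace.countableBasis X,
      ∀ᶠ x in residual X, ∃ n, g n x ∈ U := by
    intro U hU
    have hUo := TopologicalSpace.isOpen_of_mem_countableBasis hU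
    refine residual_of_dense_open ?_ ?_
    · rw [Set.ofPred_exists]
      exact isOpen_iUnion fun n => hUo.preimage (hg n)
    · rw [dense_iff_inter_open]
      intro V hV hVne
      obtain ⟨n, v, hv, hn⟩ := h U V hUo hV
        (TopologicalSpace.nonempty_of_mem_countableBasis hU) hVne
      exact ⟨v, hv, n, hn⟩
  have := (eventually_countable_ball (TopologicalSpace.countable_countableBasis X)).2 key
  filter_upwards [this] with x hx
  rw [(TopologicalSpace.isBasis_countableBasis X).dense_iff]
  intro U hU _
  obtain ⟨n, hn⟩ := hx U hU
  exact ⟨_, hn, n, rfl⟩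

variable [CompactSpace X]

theorem residual_hasDenseHalfOrbits (hiso : ∀ x : X, ¬ IsOpen ({x} : Set X))
    (hf : IsTransitiveHomeo f) : ∀ᶠ x in residual X, HasDenseHalfOrbits f x := by
  refine Filter.Eventually.and ?_ ?_
  · refine residual_dense_range (fun (n : ℕ) x => (f ^ (n : ℤ)) x)
      (fun n => (f ^ (n : ℤ)).continuous) fun U V hU hV hUne hVne => ?_
    exact exists_visit hiso hf hU hV hUne hVne
  · refine residual_dense_range (fun (n : ℕ) x => (f ^ (-(n : ℤ))) x)
      (fun n => (f ^ (-(n : ℤ))).continuous) fun U V hU hV hUne hVne => ?_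
    obtain ⟨n, v, hv, hn⟩ := exists_visit hiso hf hV hU hVne hUne
    refine ⟨n, _, hn, ?_⟩
    simpa [← zpow_add_apply] using hv

/-- Any nonempty open set contains a point with dense half orbits whose orbit avoids a given
countable set. -/
theorem exists_fresh (hiso : ∀ x : X, ¬ IsOpen ({x} : Set X)) (hf : IsTransitiveHomeo f)
    {S : Set X} (hS : S.Countable) {U : Set X} (hU : IsOpen U) (hne : U.Nonempty) :
    ∃ t ∈ U, HasDenseHalfOrbits f t ∧ ∀ k : ℤ, (f ^ k) t ∉ S := by
  have h1 : ∀ᶠ t in residual X, ∀ k : ℤ, ∀ s ∈ S, (f ^ k) t ≠ s := by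
    rw [eventually_countable_forall]
    intro k
    rw [eventually_countable_ball hS]
    intro s _
    have h2 : {t | (f ^ k) t ≠ s} = {(f ^ (-k)) s}ᶜ := by
      ext t
      have := zpow_apply_eq_iff f k 0 t s
      simp at this
      simp [this]
    refine residual_of_dense_open (s := {t | (f ^ k) t ≠ s}) ?_ ?_
    · rw [h2]; exact isOpen_compl_singleton
    · rw [h2]
      exact dense_compl_singleton_iff_not_open.2 (hiso _)
  have h3 := (residual_hasDenseHalfOrbits hiso hf).and h1
  obtain ⟨t, ht, ht2⟩ := (dense_of_mem_residual h3).inter_open_nonempty U hU hne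
  exact ⟨t, ht, ht2.1, fun k hk => ht2.2 k _ hk rfl⟩

omit [CompactSpace X] in
-- A coincidence would make the orbit periodic, hence finite; being dense, it would be all of `X`,
-- which would then be discrete.
theorem HasDenseHalfOrbits.zpow_ne (hiso : ∀ x : X, ¬ IsOpen ({x} : Set X)) {t : X}
    (ht : HasDenseHalfOrbits f t) {i j : ℤ} (h : (f ^ i) t = (f ^ j) t) : i = j := by
  by_contra hij
  wlog hlt : i < j generalizing i j
  · exact this h.symm (Ne.symm hij) (lt_of_le_of_ne (not_lt.1 hlt) (Ne.symm hij))
  have hk : (f ^ (j - i)) t = t := ((zpow_apply_eq_iff f i j t t).1 h).symm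
  have hper : ∀ q : ℤ, (f ^ ((j - i) * q)) t = t := by
    intro q
    rw [zpow_mul]
    have : Function.IsFixedPt ⇑(f ^ (j - i)) t := hk
    induction q using Int.induction_on with
    | zero => rfl
    | succ q ih => rw [zpow_one_add_apply, ih, hk]
    | pred q ih =>
      have e := zpow_one_add_apply (f ^ (j - i)) (-(q : ℤ) - 1) t
      rw [sub_add_cancel, ih] at e
      exact (f ^ (j - i)).injective (e.symm.trans hk.symm)
  have hfin : (Set.range fun n : ℕ => (f ^ (n : ℤ)) t).Finite := by
    refine ((Set.finite_Ico (0 : ℤ) (j - i)).image fun k => (f ^ k) t).subset ?_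
    rintro _ ⟨n, rfl⟩
    refine ⟨(n : ℤ) % (j - i), ⟨Int.emod_nonneg _ (by omega), Int.emod_lt_of_pos _ (by omega)⟩, ?_⟩
    have := hper ((n : ℤ) / (j - i))
    simp only
    conv_rhs => rw [← Int.emod_add_mul_ediv (n : ℤ) (j - i), zpow_add_apply, this]
  have huniv : (Set.univ : Set X).Finite := by
    rw [← ht.1.closure_eq, hfin.isClosed.closure_eq]; exact hfin
  have : Finite X := Set.finite_univ_iff.1 huniv
  exact hiso t (isOpen_discrete _)

end Dynamics

/-! ### Refining finite subsets of an order -/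

section Chains

variable {L : Type v} [LinearOrder L]

/-- Consecutive elements of the finite set `G` are related by `r`. -/
def ConsecRel (r : L → L → Prop) (G : Finset L) : Prop :=
  ∀ a ∈ G, ∀ b ∈ G, a < b → (∀ c ∈ G, ¬ (a < c ∧ c < b)) → r a b

/-- Since `b` is the last element of `G` and the first of `H`, no consecutive pair of the union
straddles it. -/
theorem ConsecRel.union {r : L → L → Prop} {G H : Finset L} {b : L} (hG : ConsecRel r G)
    (hH : ConsecRel r H) (hGb : ∀ a ∈ G, a ≤ b) (hHb : ∀ a ∈ H, b ≤ a) (hbG : b ∈ G)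
    (hbH : b ∈ H) : ConsecRel r (G ∪ H) := by
  intro s hs t ht hst hc
  simp only [Finset.mem_union] at hs ht hc
  have hb := hc b (Or.inl hbG)
  have hcG : ∀ c ∈ G, ¬ (s < c ∧ c < t) := fun c h => hc c (Or.inl h)
  have hcH : ∀ c ∈ H, ¬ (s < c ∧ c < t) := fun c h => hc c (Or.inr h)
  rcases hs with hs | hs <;> rcases ht with ht | ht
  · exact hG s hs t ht hst hcG
  · rcases (hGb s hs).eq_or_lt with rfl | h1
    · exact hH _ hbH t ht hst hcH
    · rcases (hHb t ht).eq_or_lt with rfl | h2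
      · exact hG s hs _ hbG hst hcG
      · exact absurd ⟨h1, h2⟩ hb
  · exact absurd hst (not_lt.2 ((hGb t ht).trans (hHb s hs)))
  · exact hH s hs t ht hst hcH

theorem exists_consecRel_of_reflTransGen {r : L → L → Prop} {a b : L}
    (h : Relation.ReflTransGen (fun a b => a < b ∧ r a b) a b) :
    ∃ G : Finset L, a ∈ G ∧ b ∈ G ∧ (∀ c ∈ G, a ≤ c ∧ c ≤ b) ∧ ConsecRel r G := by
  induction h with
  | refl =>
    refine ⟨{a}, by simp, by simp, by simp, ?_⟩
    intro s hs t ht hst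
    simp at hs ht
    simp [hs, ht] at hst
  | @tail b c _ hbc ih =>
    obtain ⟨G, haG, hbG, hG, hr⟩ := ih
    refine ⟨G ∪ {b, c}, by simp [haG], by simp, ?_, ?_⟩
    · intro d hd
      simp only [Finset.mem_union, Finset.mem_insert, Finset.mem_singleton] at hd
      rcases hd with hd | rfl | rfl
      · exact ⟨(hG d hd).1, (hG d hd).2.trans hbc.1.le⟩
      · exact ⟨(hG _ hbG).1, hbc.1.le⟩
      · exact ⟨(hG _ hbG).1.trans hbc.1.le, le_rfl⟩
    · refine hr.union (b := b) ?_ (fun d hd => (hG d hd).2) ?_ hbG (by simp)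
      · intro s hs t ht hst _
        simp only [Finset.mem_insert, Finset.mem_singleton] at hs ht
        rcases hs with rfl | rfl <;> rcases ht with rfl | rfl
        · exact absurd hst (lt_irrefl _)
        · exact hbc.2
        · exact absurd hst hbc.1.not_gt
        · exact absurd hst (lt_irrefl _)
      · intro d hd
        simp only [Finset.mem_insert, Finset.mem_singleton] at hd
        rcases hd with rfl | rfl
        · exact le_rfl
        · exact hbc.1.le

theorem exists_consecRel_superset [BoundedOrder L] {r : L → L → Prop}
    (h : ∀ a b : L, a ≤ b → Relation.ReflTransGen (fun a b => a < b ∧ r a b) a b)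
    (F : Finset L) :
    ∃ G : Finset L, F ⊆ G ∧ ⊥ ∈ G ∧ ⊤ ∈ G ∧ ConsecRel r G := by
  -- The right end `b` is kept general so that the induction can stop at the maximum of `F` and then
  -- glue on a sequence from there to `b`.
  have key : ∀ b : L, (∀ a ∈ F, a ≤ b) →
      ∃ G : Finset L, F ⊆ G ∧ ⊥ ∈ G ∧ b ∈ G ∧ (∀ c ∈ G, c ≤ b) ∧ ConsecRel r G := by
    induction F using Finset.induction_on_max with
    | empty =>
      intro b _
      obtain ⟨G, h1, h2, h3, h4⟩ := exists_consecRel_of_reflTransGen (h ⊥ b bot_le)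
      exact ⟨G, by simp, h1, h2, fun c hc => (h3 c hc).2, h4⟩
    | insert m F hm ih =>
      intro b hb
      obtain ⟨G, h1, h2, h3, h4, h5⟩ := ih m fun a ha => (hm a ha).le
      obtain ⟨H, k1, k2, k3, k4⟩ := exists_consecRel_of_reflTransGen
        (h m b (hb m (Finset.mem_insert_self _ _)))
      refine ⟨G ∪ H, ?_, by simp [h2], by simp [k2], ?_,
        h5.union k4 h4 (fun c hc => (k3 c hc).1) h3 k1⟩
      · intro c hc
        rcases Finset.mem_insert.1 hc with rfl | hc
        · simp [h3]
        · simp [h1 hc]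
      · intro c hc
        rcases Finset.mem_union.1 hc with hc | hc
        · exact (h4 c hc).trans ((k3 m k1).2)
        · exact (k3 c hc).2
  obtain ⟨G, h1, h2, h3, _, h4⟩ := key ⊤ fun _ _ => le_top
  exact ⟨G, h1, h2, h3, h4⟩

end Chains

/-! ### From a chained map to a nested sequence of chains -/

section Realization

variable {X : Type u} [MetricSpace X] {f : X → X} {x y : X}
variable {L : Type v} [LinearOrder L] [BoundedOrder L] [Nontrivial L]

/-- The relation "`p b` is `ε`-close to the image of `p a`". -/
def StepRel (f : X → X) (p : L → X) (ε : ℝ) (a b : L) : Prop := dist (f (p a)) (p b) < ε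

/-- `p` is injective, except that the extreme elements may have the same image. -/
def InjectiveUpToEnds (p : L → X) : Prop :=
  ∀ a b : L, a < b → p a = p b → a = ⊥ ∧ b = ⊤

omit [Nontrivial L] in
theorem card_eq_of_bot_mem {G : Finset L} (h : ⊥ ∈ G) : G.card = G.card - 1 + 1 :=
  (Nat.sub_add_cancel (Finset.card_pos.2 (show G.Nonempty from ⟨⊥, h⟩))).symm

/-- The chain through the images of the elements of a finite set. -/
noncomputable def chainOfFinset (p : L → X) {ε : ℝ} (G : Finset L) (hbot : ⊥ ∈ G) (htop : ⊤ ∈ G)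
    (hG : ConsecRel (StepRel f p ε) G) : EpsChain f ε (p ⊥) (p ⊤) where
  len := G.card - 1
  len_pos := by
    have : 1 < G.card := Finset.one_lt_card.2 ⟨⊥, hbot, ⊤, htop, bot_ne_top⟩
    omega
  pt i := p (G.orderEmbOfFin (card_eq_of_bot_mem hbot) i)
  first := by
    congr 1
    have h : (⊥ : L) ∈ Set.range
        (G.orderEmbOfFin (card_eq_of_bot_mem hbot)) := by
      rw [Finset.range_orderEmbOfFin]; exact hbot
    obtain ⟨i, hi⟩ := h
    exact le_bot_iff.1 (((OrderEmbedding.monotone _) (Fin.zero_le i)).trans_eq hi)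
  last := by
    congr 1
    have h : (⊤ : L) ∈ Set.range
        (G.orderEmbOfFin (card_eq_of_bot_mem hbot)) := by
      rw [Finset.range_orderEmbOfFin]; exact htop
    obtain ⟨i, hi⟩ := h
    exact top_le_iff.1 (hi.ge.trans ((OrderEmbedding.monotone _) (Fin.le_last i)))
  step i := by
    refine hG _ (Finset.orderEmbOfFin_mem _ _ _) _ (Finset.orderEmbOfFin_mem _ _ _)
      ((OrderEmbedding.lt_iff_lt _).2 i.castSucc_lt_succ) ?_
    intro c hc
    rw [← Finset.mem_coe, ← Finset.range_orderEmbOfFin G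
      (card_eq_of_bot_mem hbot)] at hc
    obtain ⟨j, rfl⟩ := hc
    simp only [OrderEmbedding.lt_iff_lt, Fin.lt_def, Fin.val_castSucc, Fin.val_succ]
    omega

variable {p : L → X} {ε : ℝ} {G : Finset L} {hbot : ⊥ ∈ G} {htop : ⊤ ∈ G}
  {hG : ConsecRel (StepRel f p ε) G}

theorem support_chainOfFinset : (chainOfFinset p G hbot htop hG).support = p '' G := by
  rw [← Finset.range_orderEmbOfFin G (card_eq_of_bot_mem hbot),
    ← Set.range_comp]
  rfl

omit [MetricSpace X] [Nontrivial L] in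
theorem InjectiveUpToEnds.eq (hp : InjectiveUpToEnds p) {a b : L} (ha : a ≠ ⊥) (ha' : a ≠ ⊤)
    (h : p a = p b) : a = b := by
  rcases lt_trichotomy a b with h1 | h1 | h1
  · exact absurd (hp a b h1 h).1 ha
  · exact h1
  · exact absurd (hp b a h1 h.symm).2 ha'

omit [Nontrivial L] in
theorem orderEmb_ne_bot {i : Fin (G.card - 1 + 1)} (hi : i ≠ 0) :
    G.orderEmbOfFin (card_eq_of_bot_mem hbot) i ≠ ⊥ := by
  have h := (OrderEmbedding.lt_iff_lt (G.orderEmbOfFin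
    (card_eq_of_bot_mem hbot))).2 (Fin.pos_iff_ne_zero.2 hi)
  exact (bot_le.trans_lt h).ne'

omit [Nontrivial L] in
theorem orderEmb_ne_top {i : Fin (G.card - 1 + 1)} (hi : i ≠ Fin.last _) :
    G.orderEmbOfFin (card_eq_of_bot_mem hbot) i ≠ ⊤ := by
  have h := (OrderEmbedding.lt_iff_lt (G.orderEmbOfFin
    (card_eq_of_bot_mem hbot))).2 (Fin.lt_last_iff_ne_last.2 hi)
  exact (h.trans_le le_top).ne

theorem isAcyclic_chainOfFinset (hp : InjectiveUpToEnds p) :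
    (chainOfFinset p G hbot htop hG).IsAcyclic := by
  refine ⟨fun i j hi hi' _ _ hij h => hij ?_, fun i hi hi' => ⟨fun h => hi ?_, fun h => hi' ?_⟩⟩
  all_goals
    have h2 := hp.eq (orderEmb_ne_bot (hbot := hbot) hi) (orderEmb_ne_top (hbot := hbot) hi') h
    exact (G.orderEmbOfFin (card_eq_of_bot_mem hbot)).injective h2

/-- An interior point occurs only once in the chain, so its first index is its position in `G`. -/
theorem noLater_chainOfFinset (hp : InjectiveUpToEnds p) {a b : L} (ha : a ∈ G) (hb : b ∈ G)
    (ha1 : a ≠ ⊥) (ha2 : a ≠ ⊤) (hb1 : b ≠ ⊥) (hb2 : b ≠ ⊤) :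
    (chainOfFinset p G hbot htop hG).NoLater (p a) (p b) ↔ a ≤ b := by
  have key : ∀ c ∈ G, c ≠ ⊥ → c ≠ ⊤ →
      ∃ i : Fin ((chainOfFinset p G hbot htop hG).len + 1),
      G.orderEmbOfFin (card_eq_of_bot_mem hbot) i = c ∧
      (chainOfFinset p G hbot htop hG).firstIndex (p c) = i := by
    intro c hc h1 h2
    obtain ⟨h, e⟩ := (chainOfFinset p G hbot htop hG).firstIndex_spec (z := p c)
      (by rw [support_chainOfFinset]; exact ⟨c, hc, rfl⟩)
    exact ⟨⟨_, h⟩, (hp.eq h1 h2 e.symm).symm, rfl⟩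
  obtain ⟨i, rfl, hi⟩ := key a ha ha1 ha2
  obtain ⟨j, rfl, hj⟩ := key b hb hb1 hb2
  rw [EpsChain.NoLater, hi, hj]
  exact (OrderEmbedding.le_iff_le (G.orderEmbOfFin (card_eq_of_bot_mem hbot))).symm

/-- If `p` maps a countable bounded order to `X` in such a way that the image is chained along the
order at every scale, then the order without its end points is a limit order. -/
theorem exists_orderCompatibleSeq [Countable L] (hp : InjectiveUpToEnds p)
    (h : ∀ ε : ℝ, 0 < ε → ∀ a b : L, a ≤ b →
      Relation.ReflTransGen (fun a b => a < b ∧ StepRel f p ε a b) a b) :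
    ∃ S : OrderCompatibleSeq f (p ⊥) (p ⊤), Nonempty (Set.Ioo (⊥ : L) ⊤ ≃o S.Limit) := by
  classical
  obtain ⟨l, hl⟩ := exists_surjective_nat L
  choose! G hFG hbot htop hG using fun (ε : ℝ) (hε : 0 < ε) (F : Finset L) =>
    exists_consecRel_superset (h ε hε) F
  let ε : ℕ → ℝ := fun n => 1 / ((n : ℝ) + 1)
  have hε : ∀ n, 0 < ε n := fun n => Nat.one_div_pos_of_nat
  let H : ℕ → Finset L := fun n => Nat.rec (G (ε 0) {l 0})
    (fun n Hn => G (ε (n + 1)) (insert (l (n + 1)) Hn)) n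
  have hH : ∀ n, ∃ F, H n = G (ε n) F := by
    rintro (_ | n)
    · exact ⟨_, rfl⟩
    · exact ⟨_, rfl⟩
  have hHbot : ∀ n, ⊥ ∈ H n := fun n => by
    obtain ⟨F, e⟩ := hH n; rw [e]; exact hbot _ (hε n) F
  have hHtop : ∀ n, ⊤ ∈ H n := fun n => by
    obtain ⟨F, e⟩ := hH n; rw [e]; exact htop _ (hε n) F
  have hHG : ∀ n, ConsecRel (StepRel f p (ε n)) (H n) := fun n => by
    obtain ⟨F, e⟩ := hH n; rw [e]; exact hG _ (hε n) F
  have hlH : ∀ n, l n ∈ H n := by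
    rintro (_ | n)
    · exact hFG _ (hε 0) _ (by simp)
    · exact hFG _ (hε (n + 1)) _ (by simp)
  have hsub : ∀ n, H n ⊆ H (n + 1) := fun n =>
    (Finset.subset_insert _ _).trans (hFG _ (hε (n + 1)) _)
  clear_value H
  have hmem : ∀ n, ∀ z ∈ (chainOfFinset p (H n) (hHbot n) (hHtop n) (hHG n)).support \ {p ⊥, p ⊤},
      ∃ a ∈ H n, a ≠ ⊥ ∧ a ≠ ⊤ ∧ p a = z := by
    rintro n z ⟨hz, hz'⟩
    rw [support_chainOfFinset] at hz
    obtain ⟨a, ha, rfl⟩ := hz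
    refine ⟨a, ha, ?_, ?_, rfl⟩ <;> rintro rfl <;> simp at hz'
  let S : OrderCompatibleSeq f (p ⊥) (p ⊤) :=
    { ε := ε
      ε_pos := hε
      ε_anti := fun m n hmn => Nat.one_div_le_one_div hmn
      ε_lim := tendsto_one_div_add_atTop_nhds_zero_nat
      chain := fun n => chainOfFinset p (H n) (hHbot n) (hHtop n) (hHG n)
      acyclic := fun n => isAcyclic_chainOfFinset hp
      nested := fun n => by
        rw [support_chainOfFinset, support_chainOfFinset]
        exact Set.image_mono (by exact_mod_cast hsub n)
      compat := fun n z hz w hw hzw => by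
        obtain ⟨a, ha, ha1, ha2, rfl⟩ := hmem n z hz
        obtain ⟨b, hb, hb1, hb2, rfl⟩ := hmem n w hw
        rw [noLater_chainOfFinset hp ha hb ha1 ha2 hb1 hb2] at hzw
        rwa [noLater_chainOfFinset hp (hsub n ha) (hsub n hb) ha1 ha2 hb1 hb2] }
  have hsupp : ∀ n, (S.chain n).support = p '' (H n) :=
    fun n => support_chainOfFinset (hbot := hHbot n) (htop := hHtop n) (hG := hHG n)
  have hHm : Monotone H := monotone_nat_of_le_succ hsub
  have hpne : ∀ a : L, a ≠ ⊥ → a ≠ ⊤ → p a ∉ ({p ⊥, p ⊤} : Set X) := by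
    rintro a h1 h2 (h3 | h3)
    · exact h1 (hp.eq h1 h2 h3)
    · exact h2 (hp.eq h1 h2 h3)
  let φ : Set.Ioo (⊥ : L) ⊤ → S.Limit := fun a => ⟨p a, by
    obtain ⟨n, hn⟩ := hl a
    refine ⟨Set.mem_iUnion.2 ⟨n, ?_⟩, hpne a a.2.1.ne' a.2.2.ne⟩
    rw [hsupp]
    exact ⟨a, hn ▸ hlH n, rfl⟩⟩
  have hφ : ∀ a b, φ a ≤ φ b ↔ a ≤ b := by
    intro a b
    obtain ⟨i, hi⟩ := hl a
    obtain ⟨j, hj⟩ := hl b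
    have ha : a.1 ∈ H (max i j) := hHm (le_max_left i j) (hi ▸ hlH i)
    have hb : b.1 ∈ H (max i j) := hHm (le_max_right i j) (hj ▸ hlH j)
    have h1 := S.limitLE_iff (n := max i j) (z := p a) (w := p b)
      ⟨by rw [hsupp]; exact ⟨a, ha, rfl⟩, hpne a a.2.1.ne' a.2.2.ne⟩
      ⟨by rw [hsupp]; exact ⟨b, hb, rfl⟩, hpne b b.2.1.ne' b.2.2.ne⟩
    exact h1.trans (noLater_chainOfFinset (hbot := hHbot _) (htop := hHtop _) (hG := hHG _) hp ha hb a.2.1.ne' a.2.2.ne b.2.1.ne' b.2.2.ne)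
  refine ⟨S, ⟨StrictMono.orderIsoOfSurjective φ (strictMono_of_le_iff_le fun a b => (hφ a b).symm)
    ?_⟩⟩
  rintro ⟨z, hz, hz'⟩
  obtain ⟨n, hn⟩ := Set.mem_iUnion.1 hz
  obtain ⟨a, ha, h1, h2, rfl⟩ := hmem n z ⟨hn, hz'⟩
  exact ⟨⟨a, bot_lt_iff_ne_bot.2 h1, lt_top_iff_ne_top.2 h2⟩, rfl⟩

end Realization

/-- A diagonal construction: countably many requirements, each of which depends on finitely many
coordinates and can be met without changing finitely many given coordinates, can be met
simultaneously. -/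
theorem exists_forall_of_finite_support {ι K Y : Type*} [Countable ι] [Countable K] [Nonempty ι]
    [Nonempty K] (Q : ι → ι → Y → Y → Prop) (τ : K → (ι → Y) → Prop)
    (hne : ∃ z : ι → Y, ∀ i j, Q i j (z i) (z j))
    (hdense : ∀ k, ∀ z : ι → Y, (∀ i j, Q i j (z i) (z j)) → ∀ I : Finset ι,
      ∃ z' : ι → Y, (∀ i j, Q i j (z' i) (z' j)) ∧ (∀ i ∈ I, z' i = z i) ∧ τ k z')
    (hfin : ∀ k z, τ k z → ∃ I : Finset ι, ∀ z' : ι → Y, (∀ i ∈ I, z' i = z i) → τ k z') :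
    ∃ z : ι → Y, (∀ i j, Q i j (z i) (z j)) ∧ ∀ k, τ k z := by
  classical
  obtain ⟨e, he⟩ := exists_surjective_nat ι
  obtain ⟨κ, hκ⟩ := exists_surjective_nat K
  -- A state is an admissible family with a finite set of frozen coordinates. Stage `n` meets
  -- requirement `κ n`, then freezes its finite support together with `e n`; thus every coordinate
  -- is eventually frozen and the limit family exists.
  have step : ∀ (n : ℕ) (s : {s : (ι → Y) × Finset ι // ∀ i j, Q i j (s.1 i) (s.1 j)}),
      ∃ s' : {s : (ι → Y) × Finset ι // ∀ i j, Q i j (s.1 i) (s.1 j)},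
        s.1.2 ⊆ s'.1.2 ∧ e n ∈ s'.1.2 ∧ (∀ i ∈ s.1.2, s'.1.1 i = s.1.1 i) ∧
        ∀ z' : ι → Y, (∀ i ∈ s'.1.2, z' i = s'.1.1 i) → τ (κ n) z' := by
    rintro n ⟨⟨z, I⟩, hz⟩
    obtain ⟨z', hz', hI, hτ⟩ := hdense (κ n) z hz I
    obtain ⟨J, hJ⟩ := hfin (κ n) z' hτ
    refine ⟨⟨⟨z', insert (e n) (I ∪ J)⟩, hz'⟩, ?_, by simp, hI, fun z'' h => hJ z'' ?_⟩
    · intro i hi; simp [hi]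
    · intro i hi; exact h i (by simp [hi])
  choose F hF using step
  obtain ⟨z₀, hz₀⟩ := hne
  let s : ℕ → {s : (ι → Y) × Finset ι // ∀ i j, Q i j (s.1 i) (s.1 j)} :=
    fun n => Nat.rec ⟨⟨z₀, ∅⟩, hz₀⟩ (fun n s => F n s) n
  have hs : ∀ n, s (n + 1) = F n (s n) := fun n => rfl
  clear_value s
  have hmono : Monotone fun n => (s n).1.2 :=
    monotone_nat_of_le_succ fun n => by rw [hs]; exact (hF n (s n)).1
  have hagree : ∀ n m, n ≤ m → ∀ i ∈ (s n).1.2, (s m).1.1 i = (s n).1.1 i := by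
    intro n m hnm
    induction m, hnm using Nat.le_induction with
    | base => exact fun _ _ => rfl
    | succ m hm ih =>
      intro i hi
      rw [hs, (hF m (s m)).2.2.1 i (hmono hm hi), ih i hi]
  choose N hN using he
  have hmem : ∀ i, i ∈ (s (N i + 1)).1.2 := fun i => by
    have := (hF (N i) (s (N i))).2.1
    rwa [hN, ← hs] at this
  let z : ι → Y := fun i => (s (N i + 1)).1.1 i
  have hz : ∀ n, ∀ i ∈ (s n).1.2, z i = (s n).1.1 i := by
    intro n i hi
    rcases le_total n (N i + 1) with h | h
    · exact hagree _ _ h i hi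
    · exact (hagree _ _ h i (hmem i)).symm
  refine ⟨z, fun i j => ?_, fun k => ?_⟩
  · have hi := hmono (le_max_left (N i + 1) (N j + 1)) (hmem i)
    have hj := hmono (le_max_right (N i + 1) (N j + 1)) (hmem j)
    rw [hz _ i hi, hz _ j hj]
    exact (s (max (N i + 1) (N j + 1))).2 i j
  · obtain ⟨n, rfl⟩ := hκ k
    refine (hF n (s n)).2.2.2 z fun i hi => ?_
    rw [← hs] at hi ⊢
    exact hz _ i hi

/-! ### Joining two elements at a given scale -/

section Reach

variable {X : Type u} [MetricSpace X] {L : Type v} [LinearOrder L]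

/-- There is an increasing finite sequence from `a` to `b` whose image under `p` is an
`ε`-chain. -/
def Reach (f : X → X) (p : L → X) (ε : ℝ) : L → L → Prop :=
  Relation.ReflTransGen fun a b => a < b ∧ StepRel f p ε a b

theorem Reach.exists_finset {f : X → X} {p : L → X} {ε : ℝ} {a b : L} (h : Reach f p ε a b) :
    ∃ I : Finset L, ∀ p' : L → X, (∀ i ∈ I, p' i = p i) → Reach f p' ε a b := by
  classical
  induction h with
  | refl => exact ⟨∅, fun _ _ => .refl⟩
  | @tail b c _ hbc ih =>
    obtain ⟨I, hI⟩ := ih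
    refine ⟨insert b (insert c I), fun p' hp' => ?_⟩
    refine (hI p' fun i hi => hp' i (by simp [hi])).tail ⟨hbc.1, ?_⟩
    rw [StepRel, hp' b (by simp), hp' c (by simp)]
    exact hbc.2

theorem reach_of_forall_nat {f : X → X} {p : L → X}
    (h : ∀ (n : ℕ) (a b : L), a ≤ b → Reach f p (1 / ((n : ℝ) + 1)) a b) {ε : ℝ} (hε : 0 < ε)
    {a b : L} (hab : a ≤ b) : Reach f p ε a b := by
  obtain ⟨n, hn⟩ := exists_nat_one_div_lt hε
  exact Relation.ReflTransGen.mono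
    (r := fun a b => a < b ∧ StepRel f p (1 / ((n : ℝ) + 1)) a b)
    (p := fun a b => a < b ∧ StepRel f p ε a b)
    (fun a b h => ⟨h.1, h.2.trans hn⟩) a b (h n a b hab)

end Reach

/-! ### Dense orders: the type of the rationals -/

section Eta

variable {X : Type u} [MetricSpace X] {L : Type v} [LinearOrder L]

theorem infinite_of_no_isolated [Nonempty X] (hiso : ∀ x : X, ¬ IsOpen ({x} : Set X)) :
    Infinite X := by
  by_contra h
  rw [not_infinite_iff_finite] at h
  exact hiso (Classical.arbitrary X) (isOpen_discrete _)

variable [BoundedOrder L] [Nontrivial L]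

theorem exists_chained_map_of_denselyOrdered [CompactSpace X] [Countable L] [DenselyOrdered L]
    (hiso : ∀ x : X, ¬ IsOpen ({x} : Set X)) {f : X ≃ₜ X} (hf : IsTransitiveHomeo f) (x y : X) :
    ∃ p : L → X, p ⊥ = x ∧ p ⊤ = y ∧ InjectiveUpToEnds p ∧
      ∀ ε : ℝ, 0 < ε → ∀ a b, a ≤ b → Reach f p ε a b := by
  classical
  have key := exists_forall_of_finite_support (ι := L) (K := ℕ × L × L) (Y := X)
    (fun i j u v => (i = ⊥ → u = x) ∧ (i = ⊤ → u = y) ∧ (i < j → u = v → i = ⊥ ∧ j = ⊤))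
    (fun k z => k.2.1 ≤ k.2.2 → Reach f z (1 / ((k.1 : ℝ) + 1)) k.2.1 k.2.2)
  refine Exists.elim (key ?_ ?_ ?_) ?_
  · have : Nonempty X := ⟨x⟩
    have := infinite_of_no_isolated hiso
    obtain ⟨c, hc⟩ := exists_injective_nat L
    let t := Set.Infinite.natEmbedding _ (Set.toFinite ({x, y} : Set X)).infinite_compl
    have ht : ∀ n, (t n : X) ≠ x ∧ (t n : X) ≠ y := fun n => by
      have := (t n).2
      exact ⟨fun h => this (Or.inl h), fun h => this (Or.inr h)⟩
    refine ⟨fun l => if l = ⊥ then x else if l = ⊤ then y else t (c l), fun i j => ⟨?_, ?_, ?_⟩⟩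
    · rintro rfl; simp
    · rintro rfl; simp
    · intro hij h
      have hi : i ≠ ⊤ := (hij.trans_le le_top).ne
      have hj : j ≠ ⊥ := (bot_le.trans_lt hij).ne'
      by_cases hi' : i = ⊥ <;> by_cases hj' : j = ⊤ <;> simp only [hi, hj, hi', hj', if_true,
        if_false] at h ⊢
      · simp
      · subst hi'; exact absurd h.symm (ht _).1
      · subst hj'; rw [if_neg top_ne_bot] at h; exact absurd h (ht _).2
      · exact absurd (hc (t.injective (Subtype.ext h))) hij.ne
  · rintro ⟨n, a, b⟩ z hz I
    rcases le_or_gt b a with hab | hab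
    · exact ⟨z, hz, fun _ _ => rfl, fun h => by
        rw [le_antisymm h hab]; exact .refl⟩
    set ε : ℝ := 1 / ((n : ℝ) + 1)
    have hε : 0 < ε := Nat.one_div_pos_of_nat
    -- The orbit of `w` starts near `f (z a)`, misses all points in use, and at some time `j` has
    -- its next image near `z b`.
    obtain ⟨w, hw, hwd, hwz⟩ := exists_fresh hiso hf (Set.countable_range z)
      (Metric.isOpen_ball (x := f (z a)) (ε := ε)) ⟨_, Metric.mem_ball_self hε⟩
    obtain ⟨_, hj, ⟨j, rfl⟩⟩ := hwd.1.inter_open_nonempty (f ⁻¹' Metric.ball (z b) ε)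
      (Metric.isOpen_ball.preimage f.continuous) ⟨f.symm (z b), by simp [hε]⟩
    -- Density of the order supplies `j + 1` unfrozen places between `a` and `b` for the segment `w,
    -- …, f^j w`.
    obtain ⟨s, hs, hcard⟩ := ((Set.Ioo_infinite hab).sdiff I.finite_toSet).exists_subset_card_eq
      (j + 1)
    let g := s.orderEmbOfFin hcard
    have hg : ∀ k, g k ∈ Set.Ioo a b \ I := fun k => hs (Finset.orderEmbOfFin_mem _ _ _)
    let z' : L → X := Function.extend g (fun k => (f ^ ((k : ℕ) : ℤ)) w) z
    have hz'g : ∀ k, z' (g k) = (f ^ ((k : ℕ) : ℤ)) w := fun k => g.injective.extend_apply _ _ _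
    have hz' : ∀ i, i ∉ Set.Ioo a b \ I → z' i = z i := fun i hi =>
      Function.extend_apply' _ _ _ (by rintro ⟨k, rfl⟩; exact hi (hg k))
    refine ⟨z', fun i j => ⟨?_, ?_, ?_⟩, fun i hi => hz' i fun h => h.2 hi, fun _ => ?_⟩
    · rintro rfl
      rw [hz' _ fun h => not_lt_bot h.1.1]; exact (hz ⊥ ⊥).1 rfl
    · rintro rfl
      rw [hz' _ fun h => not_top_lt h.1.2]; exact (hz ⊤ ⊤).2.1 rfl
    · intro hij h
      by_cases hi : ∃ k, g k = i <;> by_cases hj : ∃ k, g k = j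
      · obtain ⟨k, rfl⟩ := hi
        obtain ⟨l, rfl⟩ := hj
        rw [hz'g, hz'g] at h
        have := hwd.zpow_ne hiso h
        have : k = l := by ext; exact_mod_cast this
        subst this
        exact absurd hij (lt_irrefl _)
      · obtain ⟨k, rfl⟩ := hi
        have e : z' j = z j := Function.extend_apply' _ _ _ hj
        rw [hz'g, e] at h
        exact absurd ⟨j, h.symm⟩ (hwz k)
      · obtain ⟨k, rfl⟩ := hj
        have e : z' i = z i := Function.extend_apply' _ _ _ hi
        rw [hz'g, e] at h
        exact absurd ⟨i, h⟩ (hwz k)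
      · have e1 : z' i = z i := Function.extend_apply' _ _ _ hi
        have e2 : z' j = z j := Function.extend_apply' _ _ _ hj
        rw [e1, e2] at h
        exact (hz i j).2.2 hij h
    · have hza : z' a = z a := hz' a fun h => lt_irrefl _ h.1.1
      have hzb : z' b = z b := hz' b fun h => lt_irrefl _ h.1.2
      have h0 : ∀ k : Fin (j + 1), Reach f z' ε a (g k) := by
        intro k
        induction k using Fin.induction with
        | zero =>
          refine .single ⟨(hg 0).1.1, ?_⟩
          rw [StepRel, hz'g, hza, dist_comm]
          simpa using hw
        | succ k ih =>
          refine ih.tail ⟨g.lt_iff_lt.2 k.castSucc_lt_succ, ?_⟩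
          rw [StepRel, hz'g, hz'g, Fin.val_succ, Nat.cast_succ, zpow_one_add_apply]
          simpa using hε
      refine (h0 (Fin.last j)).tail ⟨(hg _).1.2, ?_⟩
      rw [StepRel, hz'g, hzb]
      exact hj
  · rintro ⟨n, a, b⟩ z hz
    rcases le_or_gt a b with hab | hab
    · obtain ⟨I, hI⟩ := (hz hab).exists_finset
      exact ⟨I, fun z' h _ => hI z' h⟩
    · exact ⟨∅, fun _ _ h => absurd h hab.not_ge⟩
  · rintro z ⟨hz, hτ⟩
    exact ⟨z, (hz ⊥ ⊥).1 rfl, (hz ⊤ ⊤).2.1 rfl, fun a b => (hz a b).2.2,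
      fun ε hε a b => reach_of_forall_nat (fun n a b => hτ (n, a, b)) hε⟩

end Eta

/-! ### Finite condensation and block coordinates -/

section Blocks

variable {L : Type v} [LinearOrder L]

/-- There are only finitely many elements between `a` and `b`. -/
def FinClose (a b : L) : Prop := (Set.Icc a b).Finite ∧ (Set.Icc b a).Finite

theorem FinClose.symm {a b : L} (h : FinClose a b) : FinClose b a := ⟨h.2, h.1⟩

theorem Icc_finite_trans {a b c : L} (h : (Set.Icc a b).Finite) (h' : (Set.Icc b c).Finite) :
    (Set.Icc a c).Finite :=
  (h.union h').subset fun t ht => (le_total t b).imp (fun h => ⟨ht.1, h⟩) fun h => ⟨h, ht.2⟩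

/-- The finite condensation of a linear order. -/
def finCloseSetoid (L : Type v) [LinearOrder L] : Setoid L where
  r := FinClose
  iseqv := ⟨fun a => by simp [FinClose], FinClose.symm,
    fun h h' => ⟨Icc_finite_trans h.1 h'.1, Icc_finite_trans h'.2 h.2⟩⟩

theorem FinClose.refl (a : L) : FinClose a a := (finCloseSetoid L).refl a

theorem FinClose.trans {a b c : L} (h : FinClose a b) (h' : FinClose b c) : FinClose a c :=
  (finCloseSetoid L).trans h h'

/-- The signed number of steps from `a` to `b`. -/
noncomputable def signedCount (a b : L) : ℤ := (Set.Ico a b).ncard - (Set.Ico b a).ncard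

theorem signedCount_neg (a b : L) : signedCount b a = -signedCount a b := by
  simp [signedCount]

theorem signedCount_add_of_le {a b c : L} (hab : a ≤ b) (hbc : b ≤ c) (h : (Set.Icc a c).Finite) :
    signedCount a c = signedCount a b + signedCount b c := by
  have hf : (Set.Ico a c).Finite := h.subset Set.Ico_subset_Icc_self
  have h1 : (Set.Ico a c).ncard = (Set.Ico a b).ncard + (Set.Ico b c).ncard := by
    rw [← Set.Ico_union_Ico_eq_Ico hab hbc] at hf ⊢
    exact Set.ncard_union_eq (Set.Ico_disjoint_Ico_same) (hf.subset Set.subset_union_left)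
      (hf.subset Set.subset_union_right)
  simp only [signedCount, Set.Ico_eq_empty_of_le hab, Set.Ico_eq_empty_of_le hbc,
    Set.Ico_eq_empty_of_le (hab.trans hbc), h1]
  simp

theorem signedCount_add {a b c : L} (hab : FinClose a b) (hbc : FinClose b c) :
    signedCount a c = signedCount a b + signedCount b c := by
  have hac := hab.trans hbc
  rcases le_total a b with h1 | h1 <;> rcases le_total b c with h2 | h2 <;>
    rcases le_total a c with h3 | h3
  · exact signedCount_add_of_le h1 h2 hac.1
  · exact signedCount_add_of_le h1 h2 hac.1
  · have := signedCount_add_of_le h3 h2 hab.1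
    have := signedCount_neg b c
    linarith
  · have := signedCount_add_of_le h3 h1 hbc.2
    have := signedCount_neg a c
    have := signedCount_neg b c
    linarith
  · have := signedCount_add_of_le h1 h3 hbc.1
    have := signedCount_neg a b
    linarith
  · have := signedCount_add_of_le h2 h3 hab.2
    have := signedCount_neg a b
    have := signedCount_neg a c
    linarith
  all_goals
    have := signedCount_add_of_le h2 h1 hac.2
    have := signedCount_neg a b
    have := signedCount_neg a c
    have := signedCount_neg b c
    linarith

theorem signedCount_pos {a b : L} (hab : a < b) (h : FinClose a b) : 0 < signedCount a b := by
  rw [signedCount, Set.Ico_eq_empty_of_le hab.le, Set.ncard_empty]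
  have : 0 < (Set.Ico a b).ncard :=
    (Set.ncard_pos (h.1.subset Set.Ico_subset_Icc_self)).2 ⟨a, le_rfl, hab⟩
  simpa using this

theorem eq_of_signedCount_eq_zero {a b : L} (h : FinClose a b) (h0 : signedCount a b = 0) :
    a = b := by
  rcases lt_trichotomy a b with h1 | h1 | h1
  · exact absurd h0 (signedCount_pos h1 h).ne'
  · exact h1
  · have := signedCount_pos h1 h.symm
    rw [signedCount_neg] at this
    omega

theorem CovBy.finClose {a b : L} (h : a ⋖ b) : FinClose a b := by
  refine ⟨?_, by simp [Set.Icc_eq_empty_of_lt h.lt]⟩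
  rw [h.Icc_eq]
  exact Set.toFinite _

theorem CovBy.signedCount {a b : L} (h : a ⋖ b) : signedCount a b = 1 := by
  simp [_root_.signedCount, h.Ico_eq, Set.Ico_eq_empty_of_le h.le]

/-- Integer coordinates along the blocks of the finite condensation. -/
theorem exists_block_coordinates [BoundedOrder L] [Infinite L] :
    ∃ (r : L → L) (e : L → ℤ), r ⊥ = ⊥ ∧ e ⊥ = 0 ∧ r ⊤ = ⊤ ∧ e ⊤ = 0 ∧
      (∀ a b, a ⋖ b → r b = r a ∧ e b = e a + 1) ∧
      (∀ a b, r a = r b → e a = e b → a = b) ∧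
      ∀ a b, r a = r b → (Set.Icc a b).Finite := by
  classical
  let s := finCloseSetoid L
  -- The blocks of the end points are represented by the end points themselves, since their base
  -- points will be prescribed.
  let r : L → L := fun a => if FinClose a ⊥ then ⊥ else if FinClose a ⊤ then ⊤ else
    (Quotient.mk s a).out
  have hr : ∀ a, FinClose (r a) a := by
    intro a
    simp only [r]
    split_ifs with h1 h2
    · exact h1.symm
    · exact h2.symm
    · exact Quotient.exact (Quotient.out_eq (Quotient.mk s a))
  have hr2 : ∀ a b, FinClose a b → r b = r a := by
    intro a b hab
    have h1 : FinClose b ⊥ ↔ FinClose a ⊥ := ⟨hab.trans, hab.symm.trans⟩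
    have h2 : FinClose b ⊤ ↔ FinClose a ⊤ := ⟨hab.trans, hab.symm.trans⟩
    have h3 : Quotient.mk s b = Quotient.mk s a := Quotient.sound hab.symm
    simp only [r, h1, h2, h3]
  have hclose : ∀ a b, r a = r b → FinClose a b := fun a b h => (hr a).symm.trans (h ▸ hr b)
  -- Infinitude of `L` puts the end points into different blocks; otherwise `x` and `y` would have
  -- to share an orbit.
  have htop : ¬ FinClose (⊤ : L) ⊥ := fun h => by
    have := h.2
    rw [Set.Icc_bot_top] at this
    exact Set.infinite_univ this
  have hrb : r ⊥ = ⊥ := by simp [r, FinClose.refl]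
  have hrt : r ⊤ = ⊤ := by simp [r, FinClose.refl, htop]
  refine ⟨r, fun a => signedCount (r a) a, hrb, ?_, hrt, ?_, fun a b hab => ?_, fun a b h he => ?_,
    fun a b h => (hclose a b h).1⟩
  · simp [hrb, signedCount]
  · simp [hrt, signedCount]
  · have := hr2 a b hab.finClose
    refine ⟨this, ?_⟩
    change signedCount (r b) b = signedCount (r a) a + 1
    rw [this, signedCount_add (hr a) hab.finClose, hab.signedCount]
  · have h1 := hclose a b h
    have h2 := signedCount_add (hr a) h1
    refine eq_of_signedCount_eq_zero h1 ?_
    change signedCount (r a) a = signedCount (r b) b at he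
    rw [h] at h2 he
    omega

end Blocks

/-! ### Half orbits inside intervals without an extreme element -/

section Approach

variable {L : Type v} [LinearOrder L]

/-- Below any larger element of `S` the interval is finite, so an immediate successor exists;
climbing `n` covers applies `g` exactly `n` times. -/
theorem exists_iterate_of_noMax {X : Type u} {g : X → X} {p : L → X}
    (hp : ∀ a b, a ⋖ b → p b = g (p a)) {A S : Set L} (hA : A.OrdConnected) (hSA : S ⊆ A)
    (hS : ∀ s ∈ S, ∃ t ∈ S, s < t) (hfin : ∀ s ∈ S, ∀ t ∈ S, (Set.Icc s t).Finite) {c : L}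
    (hc : c ∈ S) (n : ℕ) :
    ∃ c' ∈ A, c ≤ c' ∧ p c' = g^[n] (p c) := by
  have key : ∃ c' ∈ A, c ≤ c' ∧ p c' = g^[n] (p c) ∧ ∃ s ∈ S, c' ≤ s := by
    induction n with
    | zero => exact ⟨c, hSA hc, le_rfl, rfl, c, hc, le_rfl⟩
    | succ n ih =>
      obtain ⟨c', hc'A, hcc', hpc', s, hs, hc's⟩ := ih
      obtain ⟨t, ht, hst⟩ := hS s hs
      have hlt := hc's.trans_lt hst
      have hfin' : (Set.Ioc c' t).Finite :=
        (hfin c hc t ht).subset fun u hu => ⟨hcc'.trans hu.1.le, hu.2⟩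
      obtain ⟨m, hm, hmin⟩ := hfin'.exists_minimal ⟨t, hlt, le_rfl⟩
      have hcov : c' ⋖ m := ⟨hm.1, fun u h1 h2 =>
        (hmin ⟨h1, h2.le.trans hm.2⟩ h2.le).not_gt h2⟩
      refine ⟨m, hA.out hc'A (hSA ht) ⟨hm.1.le, hm.2⟩, hcc'.trans hm.1.le, ?_, t, ht, hm.2⟩
      rw [hp _ _ hcov, hpc', Function.iterate_succ_apply']
  obtain ⟨c', h1, h2, h3, _⟩ := key
  exact ⟨c', h1, h2, h3⟩

/-- Along an interval without maximum that meets only finitely many blocks, the image of `p`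
contains a forward orbit. -/
theorem exists_mem_open_of_noMax {X : Type u} [TopologicalSpace X] {ι : Type*} {g : X → X}
    {p : L → X} (hp : ∀ a b, a ⋖ b → p b = g (p a)) {r : L → ι}
    (hr : ∀ a b, r a = r b → (Set.Icc a b).Finite)
    (hd : ∀ a, Dense (Set.range fun n : ℕ => g^[n] (p a)))
    {A : Set L} (hA : A.OrdConnected) (hmax : ∀ s ∈ A, ∃ t ∈ A, s < t) {a : L} (ha : a ∈ A)
    (J : Finset ι) (hJ : ∀ s ∈ A, a ≤ s → r s ∈ J) {U : Set X} (hU : IsOpen U)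
    (hne : U.Nonempty) : ∃ s ∈ A, a ≤ s ∧ p s ∈ U := by
  classical
  -- Some block meets the part of `A` above `a` in a nonempty set without maximum. Otherwise each of
  -- the finitely many blocks in `J` would be bounded by an element of `A`, and the largest bound
  -- would be a maximum of `A`.
  have h1 : ∃ j, (∃ s ∈ A, a ≤ s ∧ r s = j) ∧
      ∀ s ∈ A, a ≤ s → r s = j → ∃ t ∈ A, a ≤ t ∧ r t = j ∧ s < t := by
    by_contra! hcon
    have h2 : ∀ j, ∃ m ∈ A, ∀ t ∈ A, a ≤ t → r t = j → t ≤ m := by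
      intro j
      by_cases hj : ∃ s ∈ A, a ≤ s ∧ r s = j
      · obtain ⟨s, hs, hs', rfl⟩ := hj
        obtain ⟨m, hm, _, _, hm'⟩ := hcon (r s) ⟨s, hs, hs', rfl⟩
        exact ⟨m, hm, hm'⟩
      · exact ⟨a, ha, fun t ht h3 h4 => absurd ⟨t, ht, h3, h4⟩ hj⟩
    choose m hmA hm using h2
    have hne' : (insert a (J.image m)).Nonempty := ⟨a, by simp⟩
    have hM := Finset.max'_mem _ hne'
    set M := (insert a (J.image m)).max' hne'
    have hMA : M ∈ A := by
      rcases Finset.mem_insert.1 hM with h | h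
      · rw [h]; exact ha
      · obtain ⟨j, _, hj⟩ := Finset.mem_image.1 h
        rw [← hj]; exact hmA j
    have haM : a ≤ M := Finset.le_max' _ _ (by simp)
    obtain ⟨t, ht, hMt⟩ := hmax M hMA
    have hrt := hJ t ht (haM.trans hMt.le)
    have : t ≤ M := (hm (r t) t ht (haM.trans hMt.le) rfl).trans
      (Finset.le_max' _ _ (Finset.mem_insert_of_mem (Finset.mem_image_of_mem m hrt)))
    exact this.not_gt hMt
  obtain ⟨j, ⟨c, hcA, hac, hcj⟩, hj⟩ := h1
  obtain ⟨_, hn, ⟨n, rfl⟩⟩ := (hd c).inter_open_nonempty U hU hne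
  obtain ⟨c', h1, h2, h3⟩ := exists_iterate_of_noMax hp hA
    (S := {s | s ∈ A ∧ a ≤ s ∧ r s = j}) (fun s hs => hs.1)
    (fun s hs => by
      obtain ⟨t, h1, h2, h3, h4⟩ := hj s hs.1 hs.2.1 hs.2.2
      exact ⟨t, ⟨h1, h2, h3⟩, h4⟩)
    (fun s hs t ht => hr s t (hs.2.2.trans ht.2.2.symm)) ⟨hcA, hac, hcj⟩ n
  exact ⟨c', h1, hac.trans h2, h3 ▸ hn⟩

theorem exists_mem_open_of_noMin {X : Type u} [TopologicalSpace X] {ι : Type*} {g : X ≃ X}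
    {p : L → X} (hp : ∀ a b, a ⋖ b → p b = g (p a)) {r : L → ι}
    (hr : ∀ a b, r a = r b → (Set.Icc a b).Finite)
    (hd : ∀ a, Dense (Set.range fun n : ℕ => g.symm^[n] (p a)))
    {A : Set L} (hA : A.OrdConnected) (hmin : ∀ s ∈ A, ∃ t ∈ A, t < s) {a : L} (ha : a ∈ A)
    (J : Finset ι) (hJ : ∀ s ∈ A, s ≤ a → r s ∈ J) {U : Set X} (hU : IsOpen U)
    (hne : U.Nonempty) : ∃ s ∈ A, s ≤ a ∧ p s ∈ U := by
  refine exists_mem_open_of_noMax (L := Lᵒᵈ) (g := g.symm) (p := p ∘ OrderDual.ofDual)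
    (r := r ∘ OrderDual.ofDual) (A := OrderDual.ofDual ⁻¹' A) (a := OrderDual.toDual a)
    (fun a b hab => ?_) (fun a b hab => ?_) (fun a => hd a.ofDual) hA.dual
    (fun s hs => hmin s.ofDual hs) ha J hJ hU hne
  · exact ((Equiv.symm_apply_eq g).2 (hp _ _ hab.ofDual)).symm
  · have := hr b.ofDual a.ofDual hab.symm
    exact this.subset fun t ht => ⟨ht.2, ht.1⟩

end Approach

/-! ### Condensation in scattered orders -/

section Scattered

variable {L : Type v} [LinearOrder L]

/-- In an order without a copy of `ℚ`, a transitive relation that holds for covering pairs and can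
be extended across cuts that are not jumps holds everywhere. -/
theorem rel_of_isEmpty_rat_embedding (hL : IsEmpty (ℚ ↪o L)) {R : L → L → Prop}
    (hrefl : ∀ a, R a a) (htrans : ∀ a b c, R a b → R b c → R a c) (hcov : ∀ a b, a ⋖ b → R a b)
    (hup : ∀ A : Set L, A.OrdConnected → (∀ s ∈ A, ∃ t ∈ A, s < t) → ∀ a ∈ A,
      (∀ s ∈ A, a ≤ s → R a s) → ∀ b, (∀ s ∈ A, s < b) → R a b)
    (hdown : ∀ A : Set L, A.OrdConnected → (∀ s ∈ A, ∃ t ∈ A, t < s) → ∀ b ∈ A,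
      (∀ s ∈ A, s ≤ b → R s b) → ∀ a, (∀ s ∈ A, a < s) → R a b)
    (a b : L) (hab : a ≤ b) : R a b := by
  -- `E a b` demands `R` throughout the interval spanned by `a` and `b`. This is an equivalence
  -- relation with convex classes; if there are two classes, representatives will form a dense
  -- order.
  let E : L → L → Prop := fun a b => ∀ c d, c ≤ d → min a b ≤ c → d ≤ max a b → R c d
  have hE : ∀ {a b}, a ≤ b → (E a b ↔ ∀ c d, c ≤ d → a ≤ c → d ≤ b → R c d) := by
    intro a b h
    simp only [E, min_eq_left h, max_eq_right h]
  have hErefl : ∀ a, E a a := by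
    intro a
    rw [hE le_rfl]
    intro c d h1 h2 h3
    rw [le_antisymm h1 (h3.trans h2)]
    exact hrefl _
  have hEsymm : ∀ {a b}, E a b → E b a := by
    intro a b h
    simpa only [E, min_comm b a, max_comm b a] using h
  have hEsub : ∀ {a b c d}, a ≤ c → c ≤ d → d ≤ b → E a b → E c d := by
    intro a b c d h1 h2 h3 h
    rw [hE (h1.trans (h2.trans h3))] at h
    rw [hE h2]
    exact fun s t hst hs ht => h s t hst (h1.trans hs) (ht.trans h3)
  have hEadd : ∀ {a b c}, a ≤ b → b ≤ c → E a b → E b c → E a c := by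
    intro a b c h1 h2 hab hbc
    rw [hE h1] at hab
    rw [hE h2] at hbc
    rw [hE (h1.trans h2)]
    intro s t hst hs ht
    rcases le_total t b with h | h
    · exact hab s t hst hs h
    · rcases le_total b s with h' | h'
      · exact hbc s t hst h' ht
      · exact htrans s b t (hab s b h' hs le_rfl) (hbc b t h le_rfl ht)
  have hEtrans : ∀ {a b c}, E a b → E b c → E a c := by
    intro a b c hab hbc
    rcases le_total a b with h1 | h1 <;> rcases le_total b c with h2 | h2
    · exact hEadd h1 h2 hab hbc
    · rcases le_total a c with h3 | h3
      · exact hEsub le_rfl h3 h2 hab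
      · exact hEsymm (hEsub le_rfl h3 h1 (hEsymm hbc))
    · rcases le_total a c with h3 | h3
      · exact hEsub h1 h3 le_rfl hbc
      · exact hEsymm (hEsub h2 h3 le_rfl (hEsymm hab))
    · exact hEsymm (hEadd h2 h1 (hEsymm hbc) (hEsymm hab))
  let s : Setoid L := ⟨E, hErefl, hEsymm, hEtrans⟩
  by_contra hnot
  have hnE : ¬ E a b := fun h => hnot ((hE hab).1 h a b hab le_rfl le_rfl)
  let S : Set L := Set.range fun q : Quotient s => q.out
  have hout : ∀ c, E (Quotient.mk s c).out c := fun c =>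
    Quotient.exact (Quotient.out_eq (Quotient.mk s c))
  have hS : ∀ u ∈ S, ∀ v ∈ S, E u v → u = v := by
    rintro _ ⟨q, rfl⟩ _ ⟨q', rfl⟩ h
    have : Quotient.mk s q.out = Quotient.mk s q'.out := Quotient.sound h
    rw [Quotient.out_eq, Quotient.out_eq] at this
    rw [this]
  have hnt : Nontrivial S := by
    refine ⟨⟨_, Quotient.mk s a, rfl⟩, ⟨_, Quotient.mk s b, rfl⟩, fun h => hnE ?_⟩
    have h' : (Quotient.mk s a).out = (Quotient.mk s b).out := congrArg Subtype.val h
    have h2 := hout b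
    rw [← h'] at h2
    exact hEtrans (hEsymm (hout a)) h2
  -- If no representative lies strictly between `u` and `v`, the interval is cut into the part `A`
  -- equivalent to `u` and the part `B` equivalent to `v`. The cut is crossed by `hup` if `A` has no
  -- maximum, by `hdown` if `B` has no minimum, and by `hcov` otherwise, so `u` and `v` would be
  -- equivalent.
  have hdense : DenselyOrdered S := by
    refine ⟨fun ⟨u, hu⟩ ⟨v, hv⟩ huv => ?_⟩
    by_contra! hcon
    have huv : u < v := huv
    have hnuv : ¬ E u v := fun h => huv.ne (hS u hu v hv h)
    have hcover : ∀ c, u ≤ c → c ≤ v → E u c ∨ E c v := by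
      intro c h1 h2
      have hmem : (Quotient.mk s c).out ∈ S := ⟨_, rfl⟩
      have hc := hout c
      rcases le_or_gt (Quotient.mk s c).out u with h | h
      · exact Or.inl (hEsub h h1 le_rfl hc)
      · have h3 : v ≤ (Quotient.mk s c).out := hcon ⟨_, hmem⟩ h
        exact Or.inr (hEsub le_rfl h2 h3 (hEsymm hc))
    let A : Set L := {c | u ≤ c ∧ c ≤ v ∧ E u c}
    let B : Set L := {c | u ≤ c ∧ c ≤ v ∧ E c v}
    have hAB : ∀ c ∈ A, ∀ d ∈ B, c < d := by
      intro c hc d hd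
      by_contra! h
      exact hnuv (hEtrans (hEsub le_rfl hd.1 h hc.2.2) hd.2.2)
    have hAo : A.OrdConnected := ⟨fun c hc d hd t ht =>
      ⟨hc.1.trans ht.1, ht.2.trans hd.2.1, hEsub le_rfl (hc.1.trans ht.1) ht.2 hd.2.2⟩⟩
    have hBo : B.OrdConnected := ⟨fun c hc d hd t ht =>
      ⟨hc.1.trans ht.1, ht.2.trans hd.2.1, hEsub ht.1 (ht.2.trans hd.2.1) le_rfl hc.2.2⟩⟩
    have hAR : ∀ c ∈ A, ∀ d ∈ A, c ≤ d → R c d := fun c hc d hd hcd =>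
      (hE hd.1).1 hd.2.2 c d hcd hc.1 le_rfl
    have hBR : ∀ c ∈ B, ∀ d ∈ B, c ≤ d → R c d := fun c hc d hd hcd =>
      (hE hc.2.1).1 hc.2.2 c d hcd le_rfl hd.2.1
    refine hnuv ((hE huv.le).2 fun c d hcd huc hdv => ?_)
    rcases hcover c huc (hcd.trans hdv) with hc | hc <;>
      rcases hcover d (huc.trans hcd) hdv with hd | hd
    · exact hAR c ⟨huc, hcd.trans hdv, hc⟩ d ⟨huc.trans hcd, hdv, hd⟩ hcd
    · have hcA : c ∈ A := ⟨huc, hcd.trans hdv, hc⟩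
      have hdB : d ∈ B := ⟨huc.trans hcd, hdv, hd⟩
      by_cases hmax : ∀ s ∈ A, ∃ t ∈ A, s < t
      · exact hup A hAo hmax c hcA (fun s hs h => hAR c hcA s hs h) d fun s hs => hAB s hs d hdB
      by_cases hmin : ∀ s ∈ B, ∃ t ∈ B, t < s
      · exact hdown B hBo hmin d hdB (fun s hs h => hBR s hs d hdB h) c
          fun s hs => hAB c hcA s hs
      push Not at hmax hmin
      obtain ⟨m, hm, hm'⟩ := hmax
      obtain ⟨n, hn, hn'⟩ := hmin
      refine htrans c n d (htrans c m n (hAR c hcA m hm (hm' c hcA)) (hcov m n ⟨hAB m hm n hn, ?_⟩))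
        (hBR n hn d hdB (hn' d hdB))
      intro t h1 h2
      have hut := hm.1.trans h1.le
      have htv := h2.le.trans hn.2.1
      rcases hcover t hut htv with ht | ht
      · exact (hm' t ⟨hut, htv, ht⟩).not_gt h1
      · exact (hn' t ⟨hut, htv, ht⟩).not_gt h2
    · exact absurd hcd (hAB d ⟨huc.trans hcd, hdv, hd⟩ c ⟨huc, hcd.trans hdv, hc⟩).not_ge
    · exact hBR c ⟨huc, hcd.trans hdv, hc⟩ d ⟨huc.trans hcd, hdv, hd⟩ hcd
  obtain ⟨g⟩ := Order.embedding_from_countable_to_dense ℚ S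
  exact hL.false (g.trans (OrderEmbedding.subtype S))

end Scattered

/-! ### Scattered orders: one orbit per block -/

section BlockMaps

variable {X : Type u} [MetricSpace X] {L : Type v}

/-- `u` and `v` lie on different orbits. -/
def OrbitsDiffer (f : X ≃ₜ X) (u v : X) : Prop := ∀ k : ℤ, v ≠ (f ^ k) u

theorem OrbitsDiffer.symm {f : X ≃ₜ X} {u v : X} (h : OrbitsDiffer f u v) :
    OrbitsDiffer f v u := by
  intro k hk
  refine h (-k) ?_
  have := (zpow_apply_eq_iff f 0 k u v).1 (by simpa using hk)
  rw [hk, ← zpow_add_apply]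
  simp

/-- The map that follows the orbit of `z (r l)` for `e l` steps. -/
def blockMap (f : X ≃ₜ X) (r : L → L) (e : L → ℤ) (z : L → X) (l : L) : X := (f ^ e l) (z (r l))

theorem blockMap_congr {f : X ≃ₜ X} {r : L → L} {e : L → ℤ} {z z' : L → X} {l : L}
    (h : z' (r l) = z (r l)) : blockMap f r e z' l = blockMap f r e z l := by
  rw [blockMap, h, blockMap]

theorem HasDenseHalfOrbits.zpow {f : X ≃ₜ X} {u : X} (h : HasDenseHalfOrbits f u) (k : ℤ) :
    HasDenseHalfOrbits f ((f ^ k) u) := by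
  have key : ∀ c : ℕ → ℤ, Dense (Set.range fun n => (f ^ c n) u) →
      Dense (Set.range fun n => (f ^ c n) ((f ^ k) u)) := by
    intro c hc
    have := (f ^ k).surjective.denseRange.dense_image (f ^ k).continuous hc
    rw [← Set.range_comp] at this
    convert this using 2
    ext n
    simp only [Function.comp_apply, ← zpow_add_apply, add_comm]
  exact ⟨key _ h.1, key _ h.2⟩

variable [LinearOrder L] [BoundedOrder L]

/-- Conditions on a pair of coordinates of a choice of base points: the extreme ones are
prescribed, all half orbits are dense, and distinct coordinates lie on distinct orbits. -/
def BasePairs (f : X ≃ₜ X) (x y : X) (i j : L) (u v : X) : Prop :=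
  (i = ⊥ → u = x) ∧ (i = ⊤ → u = y) ∧ HasDenseHalfOrbits f u ∧ (i ≠ j → OrbitsDiffer f u v)

variable {f : X ≃ₜ X} {x y : X} [CompactSpace X]

theorem exists_basePairs [Nontrivial L] [Countable L] (hiso : ∀ x : X, ¬ IsOpen ({x} : Set X))
    (hf : IsTransitiveHomeo f) (hx : HasDenseHalfOrbits f x) (hy : HasDenseHalfOrbits f y)
    (hxy : OrbitsDiffer f x y) :
    ∃ z : L → X, ∀ i j, BasePairs f x y i j (z i) (z j) := by
  classical
  obtain ⟨t, ht, htt⟩ := exists_seq_of_forall_finset_exists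
    (fun t => HasDenseHalfOrbits f t ∧ OrbitsDiffer f t x ∧ OrbitsDiffer f t y)
    (fun s t => OrbitsDiffer f t s) (fun s _ => by
      obtain ⟨t, _, h1, h2⟩ := exists_fresh hiso hf
        (S := insert x (insert y (s : Set X))) ((s.countable_toSet.insert y).insert x)
        isOpen_univ ⟨x, trivial⟩
      exact ⟨t, ⟨h1, fun k h => h2 k (by simp [← h]), fun k h => h2 k (by simp [← h])⟩,
        fun u hu k h => h2 k (by simp [← h, hu])⟩)
  obtain ⟨c, hc⟩ := exists_injective_nat L
  have htt' : ∀ m n, m ≠ n → OrbitsDiffer f (t m) (t n) := fun m n h =>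
    (lt_or_gt_of_ne h).elim (fun h => (htt m n h).symm) (htt n m)
  refine ⟨fun l => if l = ⊥ then x else if l = ⊤ then y else t (c l),
    fun i j => ⟨fun h => by simp [h], fun h => by simp [h], ?_, fun hij => ?_⟩⟩
  · dsimp only
    split_ifs
    exacts [hx, hy, (ht _).1]
  · dsimp only
    split_ifs with h1 h2 h3 h4 h5 h6 h7
    · exact absurd (h1.trans h2.symm) hij
    · exact hxy
    · exact (ht _).2.1.symm
    · exact hxy.symm
    · exact absurd (h4.trans h6.symm) hij
    · exact (ht _).2.2.symm
    · exact (ht _).2.1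
    · exact (ht _).2.2
    · exact htt' _ _ (hc.ne hij)

/-- The freedom available in the scattered case: a non-extreme base point can be moved into any open
set, since a generic point there lies on a new orbit. -/
theorem exists_basePairs_update [Countable L] (hiso : ∀ x : X, ¬ IsOpen ({x} : Set X))
    (hf : IsTransitiveHomeo f) {z : L → X} (hz : ∀ i j, BasePairs f x y i j (z i) (z j)) {i : L}
    (hi : i ≠ ⊥) (hi' : i ≠ ⊤) {U : Set X} (hU : IsOpen U) (hne : U.Nonempty) :
    ∃ z' : L → X, (∀ i j, BasePairs f x y i j (z' i) (z' j)) ∧ (∀ j, j ≠ i → z' j = z j) ∧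
      z' i ∈ U := by
  classical
  obtain ⟨t, htU, ht, htz⟩ := exists_fresh hiso hf (Set.countable_range z) hU hne
  have htz' : ∀ j, OrbitsDiffer f t (z j) := fun j k h => htz k ⟨j, h⟩
  refine ⟨Function.update z i t, fun j k => ?_, fun j hj => Function.update_of_ne hj _ _, by simpa⟩
  rcases eq_or_ne j i with rfl | hj
  · refine ⟨fun h => absurd h hi, fun h => absurd h hi', by simpa, fun h => ?_⟩
    rw [Function.update_self, Function.update_of_ne h.symm]
    exact htz' k
  · rw [Function.update_of_ne hj]
    refine ⟨(hz j k).1, (hz j k).2.1, (hz j k).2.2.1, fun h => ?_⟩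
    rcases eq_or_ne k i with rfl | hk
    · rw [Function.update_self]
      exact (htz' j).symm
    · rw [Function.update_of_ne hk]
      exact (hz j k).2.2.2 h

theorem exists_chained_map_of_scattered [Countable L] [Infinite L]
    (hL : IsEmpty (ℚ ↪o L)) (hiso : ∀ x : X, ¬ IsOpen ({x} : Set X)) (hf : IsTransitiveHomeo f)
    (hx : HasDenseHalfOrbits f x) (hy : HasDenseHalfOrbits f y) (hxy : OrbitsDiffer f x y) :
    ∃ p : L → X, p ⊥ = x ∧ p ⊤ = y ∧ InjectiveUpToEnds p ∧
      ∀ ε : ℝ, 0 < ε → ∀ a b, a ≤ b → Reach f p ε a b := by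
  classical
  have : Nontrivial L := inferInstance
  obtain ⟨r, e, hrb, heb, hrt, het, hcov, hinj, hfin⟩ := exists_block_coordinates (L := L)
  let P := blockMap f r e
  let Adm : (L → X) → Prop := fun z => ∀ i j, BasePairs f x y i j (z i) (z j)
  have hPcov : ∀ z, ∀ a b, a ⋖ b → P z b = f (P z a) := by
    intro z a b hab
    obtain ⟨h1, h2⟩ := hcov a b hab
    simp only [P, blockMap, h1, h2, zpow_one_add_apply]
  have hPd : ∀ z, Adm z → ∀ a, HasDenseHalfOrbits f (P z a) := fun z hz a =>
    (hz (r a) (r a)).2.2.1.zpow _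
  have hPfin : ∀ (z : L → X) (ε : ℝ) (a b : L), Reach f (P z) ε a b →
      ∃ I : Finset L, ∀ z' : L → X, (∀ i ∈ I, z' i = z i) → Reach f (P z') ε a b := by
    intro z ε a b h
    obtain ⟨I, hI⟩ := h.exists_finset
    exact ⟨I.image r, fun z' hz' => hI _ fun i hi =>
      blockMap_congr (hz' _ (Finset.mem_image_of_mem r hi))⟩
  have hpert : ∀ (s : L) (z : L → X), Adm z → ∀ J : Finset L, ⊥ ∈ J → ⊤ ∈ J →
      r s ∉ J → ∀ U : Set X, IsOpen U → U.Nonempty →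
      ∃ z', Adm z' ∧ (∀ i ∈ J, z' i = z i) ∧ P z' s ∈ U := by
    intro s z hz J hb ht hs U hU hne
    obtain ⟨z', h1, h2, h3⟩ := exists_basePairs_update hiso hf hz (i := r s)
      (fun h => hs (h ▸ hb)) (fun h => hs (h ▸ ht)) (hU.preimage (f ^ e s).continuous)
      (hne.preimage (f ^ e s).surjective)
    exact ⟨z', h1, fun i hi => h2 i fun h => hs (h ▸ hi), h3⟩
  have hiter : ∀ (n : ℕ) (u : X), (f.toEquiv.symm)^[n] u = (f ^ (-(n : ℤ))) u := by
    intro n u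
    have : (f.toEquiv.symm)^[n] u = (f.symm)^[n] u := rfl
    rw [this, iterate_eq_zpow]
    change ((f⁻¹) ^ (n : ℤ)) u = _
    rw [inv_zpow, zpow_neg]
  -- The relation fed to the condensation lemma is "joinable by a modification off any finite set
  -- `I`", starting from any admissible family. Quantifying over both makes it transitive: the
  -- second modification freezes the support of the first connection.
  have hgood : ∀ ε : ℝ, 0 < ε → ∀ a b : L, a ≤ b → ∀ z, Adm z → ∀ I : Finset L,
      ∃ z', Adm z' ∧ (∀ i ∈ I, z' i = z i) ∧ Reach f (P z') ε a b := by
    intro ε hε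
    refine rel_of_isEmpty_rat_embedding hL ?_ ?_ ?_ ?_ ?_
    · exact fun a z hz I => ⟨z, hz, fun _ _ => rfl, .refl⟩
    · intro a b c hab hbc z hz I
      obtain ⟨z1, hz1, hI1, hr1⟩ := hab z hz I
      obtain ⟨I1, hI1'⟩ := hPfin _ _ _ _ hr1
      obtain ⟨z2, hz2, hI2, hr2⟩ := hbc z1 hz1 (I ∪ I1)
      exact ⟨z2, hz2, fun i hi => (hI2 i (by simp [hi])).trans (hI1 i hi),
        (hI1' z2 fun i hi => hI2 i (by simp [hi])).trans hr2⟩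
    · intro a b hab z hz I
      refine ⟨z, hz, fun _ _ => rfl, .single ⟨hab.lt, ?_⟩⟩
      rw [StepRel, hPcov z a b hab, dist_self]
      exact hε
    · intro A hA hmax a ha hgood b hb z hz I
      -- Frozen: the prescribed base points, the block of the target, and `I`.
      let J : Finset L := insert ⊥ (insert ⊤ (insert (r b) I))
      have hUo : IsOpen (f ⁻¹' Metric.ball (P z b) ε) := Metric.isOpen_ball.preimage f.continuous
      have hUne : (f ⁻¹' Metric.ball (P z b) ε).Nonempty := ⟨f.symm (P z b), by simp [hε]⟩
      obtain ⟨s, hsA, has, z1, hz1, hJ1, hU1⟩ : ∃ s ∈ A, a ≤ s ∧ ∃ z1, Adm z1 ∧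
          (∀ i ∈ J, z1 i = z i) ∧ P z1 s ∈ f ⁻¹' Metric.ball (P z b) ε := by
        -- Either an unfrozen block can be steered to the target, or only the finitely many blocks
        -- of `J` occur beyond `a` and a dense forward orbit in one of them reaches it unaided.
        by_cases h : ∃ s ∈ A, a ≤ s ∧ r s ∉ J
        · obtain ⟨s, hs, has, hsJ⟩ := h
          exact ⟨s, hs, has, hpert s z hz J (by simp [J]) (by simp [J]) hsJ _ hUo hUne⟩
        · push Not at h
          obtain ⟨s, hs, has, hU⟩ := exists_mem_open_of_noMax (g := f) (hPcov z) hfin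
            (fun a => by simpa only [iterate_eq_zpow] using (hPd z hz a).1) hA hmax ha J h hUo hUne
          exact ⟨s, hs, has, z, hz, fun _ _ => rfl, hU⟩
      -- The block of `s` is now frozen as well, so joining `a` to `s` keeps the last step valid.
      obtain ⟨z2, hz2, hJ2, hr2⟩ := hgood s hsA has z1 hz1 (insert (r s) J)
      refine ⟨z2, hz2, fun i hi => (hJ2 i (by simp [J, hi])).trans (hJ1 i (by simp [J, hi])),
        hr2.tail ⟨hb s hsA, ?_⟩⟩
      have e1 : P z2 s = P z1 s := blockMap_congr (hJ2 _ (by simp))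
      have e2 : P z2 b = P z b :=
        blockMap_congr ((hJ2 _ (by simp [J])).trans (hJ1 _ (by simp [J])))
      rw [StepRel, e1, e2]
      exact hU1
    · intro A hA hmin b hb hgood a ha z hz I
      let J : Finset L := insert ⊥ (insert ⊤ (insert (r a) I))
      have hUo : IsOpen (Metric.ball (f (P z a)) ε) := Metric.isOpen_ball
      have hUne : (Metric.ball (f (P z a)) ε).Nonempty := ⟨_, Metric.mem_ball_self hε⟩
      obtain ⟨s, hsA, hsb, z1, hz1, hJ1, hU1⟩ : ∃ s ∈ A, s ≤ b ∧ ∃ z1, Adm z1 ∧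
          (∀ i ∈ J, z1 i = z i) ∧ P z1 s ∈ Metric.ball (f (P z a)) ε := by
        by_cases h : ∃ s ∈ A, s ≤ b ∧ r s ∉ J
        · obtain ⟨s, hs, hsb, hsJ⟩ := h
          exact ⟨s, hs, hsb, hpert s z hz J (by simp [J]) (by simp [J]) hsJ _ hUo hUne⟩
        · push Not at h
          obtain ⟨s, hs, hsb, hU⟩ := exists_mem_open_of_noMin (g := f.toEquiv) (hPcov z) hfin
            (fun a => by simpa only [hiter] using (hPd z hz a).2) hA hmin hb J h hUo hUne
          exact ⟨s, hs, hsb, z, hz, fun _ _ => rfl, hU⟩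
      obtain ⟨z2, hz2, hJ2, hr2⟩ := hgood s hsA hsb z1 hz1 (insert (r s) J)
      refine ⟨z2, hz2, fun i hi => (hJ2 i (by simp [J, hi])).trans (hJ1 i (by simp [J, hi])),
        hr2.head ⟨ha s hsA, ?_⟩⟩
      have e1 : P z2 s = P z1 s := blockMap_congr (hJ2 _ (by simp))
      have e2 : P z2 a = P z a :=
        blockMap_congr ((hJ2 _ (by simp [J])).trans (hJ1 _ (by simp [J])))
      rw [StepRel, e1, e2, dist_comm]
      exact hU1
  obtain ⟨z, hz, hτ⟩ := exists_forall_of_finite_support (ι := L) (K := ℕ × L × L) (Y := X)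
    (BasePairs f x y) (fun k z => k.2.1 ≤ k.2.2 → Reach f (P z) (1 / ((k.1 : ℝ) + 1)) k.2.1 k.2.2)
    (exists_basePairs hiso hf hx hy hxy)
    (fun ⟨n, a, b⟩ z hz I => by
      rcases le_or_gt a b with hab | hab
      · obtain ⟨z', h1, h2, h3⟩ := hgood _ (Nat.one_div_pos_of_nat (n := n)) a b hab z hz I
        exact ⟨z', h1, h2, fun _ => h3⟩
      · exact ⟨z, hz, fun _ _ => rfl, fun h => absurd h hab.not_ge⟩)
    (fun ⟨n, a, b⟩ z h => by
      rcases le_or_gt a b with hab | hab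
      · obtain ⟨I, hI⟩ := hPfin _ _ _ _ (h hab)
        exact ⟨I, fun z' hz' _ => hI z' hz'⟩
      · exact ⟨∅, fun _ _ h => absurd h hab.not_ge⟩)
  refine ⟨P z, ?_, ?_, fun a b hab h => ?_,
    fun ε hε a b => reach_of_forall_nat (fun n a b => hτ (n, a, b)) hε⟩
  · simp only [P, blockMap, hrb, heb]
    simpa using (hz ⊥ ⊥).1 rfl
  · simp only [P, blockMap, hrt, het]
    simpa using (hz ⊤ ⊤).2.1 rfl
  · exfalso
    simp only [P, blockMap] at h
    -- Within a block injectivity is aperiodicity; across blocks the orbits are distinct.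
    by_cases hr : r a = r b
    · rw [hr] at h
      exact hab.ne (hinj a b hr ((hz (r b) (r b)).2.2.1.zpow_ne hiso h))
    · exact (hz (r b) (r a)).2.2.2 (Ne.symm hr) _ ((zpow_apply_eq_iff f _ _ _ _).1 h)

end BlockMaps

/-! ### Membership in the spectrum -/

section Spectrum

variable {X : Type u} [MetricSpace X]

theorem type_mem_emergentOrderSpectrum {f : X → X} {x y : X} {L : Type v} [LinearOrder L]
    [BoundedOrder L] [Nontrivial L] [Countable L] {K : Type u} [LinearOrder K]
    (φ : K ≃o Set.Ioo (⊥ : L) ⊤)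
    (h : ∃ p : L → X, p ⊥ = x ∧ p ⊤ = y ∧ InjectiveUpToEnds p ∧
      ∀ ε : ℝ, 0 < ε → ∀ a b, a ≤ b → Reach f p ε a b) :
    OrderType.type K ∈ emergentOrderSpectrum f x y := by
  obtain ⟨p, rfl, rfl, hp, hr⟩ := h
  obtain ⟨S, ⟨ψ⟩⟩ := exists_orderCompatibleSeq hp hr
  exact ⟨S, OrderType.type_eq_type.2 ⟨φ.trans ψ⟩⟩

/-- Any linear order is the interior of the order obtained by adding two end points. -/
noncomputable def orderIsoIooWithBotTop (L : Type v) [LinearOrder L] :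
    L ≃o Set.Ioo (⊥ : WithBot (WithTop L)) ⊤ :=
  StrictMono.orderIsoOfSurjective
    (fun a => ⟨((a : WithTop L) : WithBot (WithTop L)), WithBot.bot_lt_coe _,
      WithBot.coe_lt_coe.2 (WithTop.coe_lt_top a)⟩)
    (fun a b hab => by
      change ((a : WithTop L) : WithBot (WithTop L)) < ((b : WithTop L) : WithBot (WithTop L))
      exact WithBot.coe_lt_coe.2 (WithTop.coe_lt_coe.2 hab))
    (by
      rintro ⟨b, hb, hb'⟩
      induction b using WithBot.recBotCoe with
      | bot => exact absurd hb (lt_irrefl _)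
      | coe b =>
        induction b using WithTop.recTopCoe with
        | top => exact absurd hb' (lt_irrefl _)
        | coe b => exact ⟨b, rfl⟩)

/-- The image of the rational interval `(0, 1)` misses both added end points and still contains a
copy of `ℚ`. -/
theorem isEmpty_rat_embedding_of_isScattered {L : Type u} [LinearOrder L]
    (hL : IsScatteredOrder L) : IsEmpty (ℚ ↪o WithBot (WithTop L)) := by
  refine ⟨fun g => ?_⟩
  have : Nontrivial (Set.Ioo (0 : ℚ) 1) :=
    ⟨⟨1 / 2, by norm_num⟩, ⟨1 / 3, by norm_num⟩, by simp [Subtype.ext_iff]⟩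
  obtain ⟨h⟩ := Order.embedding_from_countable_to_dense ℚ (Set.Ioo (0 : ℚ) 1)
  let k : ℚ → Set.Ioo (⊥ : WithBot (WithTop L)) ⊤ := fun q => ⟨g (h q),
    bot_le.trans_lt (g.lt_iff_lt.2 (h q).2.1), (g.lt_iff_lt.2 (h q).2.2).trans_le le_top⟩
  have hk : StrictMono k := fun a b hab => by
    change g (h a) < g (h b)
    exact g.lt_iff_lt.2 (h.lt_iff_lt.2 hab)
  exact (hL _).false (OrderEmbedding.orderIso (f := (OrderEmbedding.ofStrictMono k hk).trans
    (orderIsoIooWithBotTop L).symm.toOrderEmbedding))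

theorem etaOrderType_mem_emergentOrderSpectrum [CompactSpace X]
    (hiso : ∀ x : X, ¬ IsOpen ({x} : Set X)) {f : X ≃ₜ X} (hf : IsTransitiveHomeo f) (x y : X) :
    etaOrderType.{u} ∈ emergentOrderSpectrum f x y := by
  rw [etaOrderType, ← OrderType.type_ulift]
  exact type_mem_emergentOrderSpectrum (ULift.orderIso.trans (orderIsoIooWithBotTop ℚ))
    (exists_chained_map_of_denselyOrdered hiso hf x y)

theorem type_mem_emergentOrderSpectrum_of_isScattered [CompactSpace X]
    (hiso : ∀ x : X, ¬ IsOpen ({x} : Set X)) {f : X ≃ₜ X} (hf : IsTransitiveHomeo f) {x y : X}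
    (hx : HasDenseHalfOrbits f x) (hy : HasDenseHalfOrbits f y) (hxy : OrbitsDiffer f x y)
    (L : Type u) [LinearOrder L] [Countable L] [Infinite L] (hL : IsScatteredOrder L) :
    OrderType.type L ∈ emergentOrderSpectrum f x y := by
  have : Countable (WithBot (WithTop L)) := inferInstanceAs (Countable (Option (Option L)))
  have : Infinite (WithBot (WithTop L)) := inferInstanceAs (Infinite (Option (Option L)))
  exact type_mem_emergentOrderSpectrum (orderIsoIooWithBotTop L)
    (exists_chained_map_of_scattered (isEmpty_rat_embedding_of_isScattered hL) hiso hf hx hy hxy)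

/-- An orbit segment realizes a finite order-type. -/
theorem type_mem_emergentOrderSpectrum_iterate {f : X → X} {x : X} {K : ℕ}
    (hinj : ∀ i j, i < j → j ≤ K + 1 → f^[i] x = f^[j] x → i = 0 ∧ j = K + 1)
    (L : Type u) [LinearOrder L] [Fintype L] (hL : Fintype.card L = K) :
    OrderType.type L ∈ emergentOrderSpectrum f x (f^[K + 1] x) := by
  have hcard : Fintype.card (Set.Ioo (⊥ : Fin (K + 2)) ⊤) = K := by
    rw [Fintype.card_ofFinset, Fin.card_Ioo]
    change K + 1 - 0 - 1 = K
    omega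
  refine type_mem_emergentOrderSpectrum (L := Fin (K + 2))
    ((Fintype.orderIsoFinOfCardEq L hL).symm.trans (Fintype.orderIsoFinOfCardEq _ hcard))
    ⟨fun i => f^[(i : ℕ)] x, rfl, rfl, fun a b hab h => ?_, fun ε hε a b hab => ?_⟩
  · obtain ⟨h1, h2⟩ := hinj a b hab (Nat.lt_succ_iff.1 b.2) h
    exact ⟨Fin.ext h1, Fin.ext h2⟩
  · induction b using Fin.induction with
    | zero =>
      rw [Fin.le_zero_iff.1 hab]
      exact .refl
    | succ b ih =>
      rcases hab.eq_or_lt with rfl | h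
      · exact .refl
      · refine (ih (Fin.le_castSucc_iff.2 h)).tail ⟨b.castSucc_lt_succ, ?_⟩
        simp only [StepRel, Fin.val_castSucc, Fin.val_succ, Function.iterate_succ_apply', dist_self]
        exact hε

/-- All chains live in one finite set. Once `ε n` is at most every positive distance from an image
`f u` to a point `v` of that set, each step is exact. -/
theorem mem_forwardOrbit_of_finite {f : X → X} {x y : X} (S : OrderCompatibleSeq f x y)
    (hfin : Finite S.Limit) : y ∈ forwardOrbit f x := by
  have hV : (S.limitSet ∪ {x, y}).Finite := by
    have h1 : S.limitSet.Finite := Set.finite_coe_iff.1 hfin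
    exact h1.union (Set.toFinite _)
  have hmem : ∀ n (i : Fin ((S.chain n).len + 1)), (S.chain n).pt i ∈ S.limitSet ∪ {x, y} := by
    intro n i
    by_cases h : (S.chain n).pt i ∈ ({x, y} : Set X)
    · exact Or.inr h
    · exact Or.inl ⟨Set.mem_iUnion.2 ⟨n, i, rfl⟩, h⟩
  have hev : ∀ᶠ n in atTop, ∀ q ∈ (S.limitSet ∪ {x, y}) ×ˢ (S.limitSet ∪ {x, y}),
      dist (f q.1) q.2 < S.ε n → f q.1 = q.2 := by
    rw [eventually_all_finite (hV.prod hV)]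
    intro q _
    rcases eq_or_ne (f q.1) q.2 with h | h
    · exact Eventually.of_forall fun _ _ => h
    · filter_upwards [S.ε_lim.eventually_lt_const (dist_pos.2 h)] with n hn hlt
      exact absurd hn hlt.not_gt
  obtain ⟨n, hn⟩ := hev.exists
  have hit : ∀ i : Fin ((S.chain n).len + 1), (S.chain n).pt i = f^[(i : ℕ)] x := by
    intro i
    induction i using Fin.induction with
    | zero => exact (S.chain n).first
    | succ i ih =>
      rw [Fin.val_succ, Function.iterate_succ_apply', ← Fin.val_castSucc, ← ih]
      exact (hn ((S.chain n).pt i.castSucc, (S.chain n).pt i.succ) ⟨hmem n _, hmem n _⟩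
        ((S.chain n).step i)).symm
  exact ⟨(S.chain n).len, (S.chain n).len_pos,
    ((S.chain n).last).symm.trans ((hit (Fin.last _)).trans (by rw [Fin.val_last]))⟩

theorem exists_finiteOrderType_mem_iff (f : X → X) (x y : X) :
    (∃ K : ℕ, finiteOrderType.{u} K ∈ emergentOrderSpectrum f x y) ↔ y ∈ forwardOrbit f x := by
  classical
  constructor
  · rintro ⟨K, S, hS⟩
    rw [finiteOrderType, ← OrderType.type_ulift, OrderType.type_eq_type] at hS
    obtain ⟨φ⟩ := hS
    exact mem_forwardOrbit_of_finite S (Finite.of_equiv _ φ.toEquiv)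
  · intro h
    have h' : ∃ k : ℕ, 0 < k ∧ y = f^[k] x := h
    obtain ⟨h0, hy⟩ := Nat.find_spec h'
    have hmin := fun m => Nat.find_min h' (m := m)
    obtain ⟨K, hK⟩ := Nat.exists_eq_succ_of_ne_zero h0.ne'
    rw [hK] at hy hmin
    refine ⟨K, ?_⟩
    rw [finiteOrderType, ← OrderType.type_ulift, hy]
    refine type_mem_emergentOrderSpectrum_iterate (fun i j hij hj he => ?_) _ (by simp)
    by_contra hne
    -- A repetition at times `i < j` can be cut out, which reaches `y` sooner; the new time is
    -- positive unless `i = 0` and `j = K + 1`.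
    refine hmin (K + 1 - j + i) (by omega) ⟨by omega, ?_⟩
    rw [Function.iterate_add_apply, he, ← Function.iterate_add_apply, Nat.sub_add_cancel hj]
    exact hy

end Spectrum

/-! ### Generic pairs and the main theorem -/

section Generic

variable {X : Type u} [MetricSpace X]

theorem residual_orbitsDiffer (hiso : ∀ x : X, ¬ IsOpen ({x} : Set X)) (f : X ≃ₜ X) :
    ∀ᶠ q in residual (X × X), OrbitsDiffer f q.1 q.2 := by
  refine eventually_countable_forall.2 fun k => residual_of_dense_open ?_ ?_
  · exact isOpen_ne_fun continuous_snd ((f ^ k).continuous.comp continuous_fst)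
  · rintro ⟨a, b⟩
    have hb : b ∈ closure ({(f ^ k) a}ᶜ : Set X) :=
      dense_compl_singleton_iff_not_open.2 (hiso _) b
    exact map_mem_closure (f := fun c => (a, c)) (by fun_prop) hb fun c hc => hc

/-- Projections are continuous and open, so preimages of residual sets under them are residual. -/
theorem residual_prod_generic [CompactSpace X] (hiso : ∀ x : X, ¬ IsOpen ({x} : Set X))
    {f : X ≃ₜ X} (hf : IsTransitiveHomeo f) :
    ∀ᶠ q in residual (X × X), HasDenseHalfOrbits f q.1 ∧ HasDenseHalfOrbits f q.2 ∧
      OrbitsDiffer f q.1 q.2 := by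
  have h := residual_hasDenseHalfOrbits hiso hf
  exact ((tendsto_residual_of_isOpenMap continuous_fst isOpenMap_fst).eventually h).and
    (((tendsto_residual_of_isOpenMap continuous_snd isOpenMap_snd).eventually h).and
      (residual_orbitsDiffer hiso f))

end Generic

theorem mainTheorem1 {X : Type u} [MetricSpace X] [CompactSpace X]
    (hiso : ∀ x : X, ¬ IsOpen ({x} : Set X))
    (hcard : Cardinal.mk X = Cardinal.continuum)
    (f : X ≃ₜ X) (hf : IsTransitiveHomeo f) :
    (∀ (L : Type u) [LinearOrder L], Countable L → IsScatteredOrder L →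
      OrderType.type L ∈ globalOrderSpectrum f) ∧
    etaOrderType.{u} ∈ globalOrderSpectrum f ∧
    (∃ M : Set (X × X), M ∈ residual (X × X) ∧ ∀ x y : X, (x, y) ∈ M →
      ∀ (L : Type u) [LinearOrder L], Countable L → Infinite L → IsScatteredOrder L →
        OrderType.type L ∈ emergentOrderSpectrum f x y) ∧
    (∀ x y : X, (∃ K : ℕ, finiteOrderType.{u} K ∈ emergentOrderSpectrum f x y) ↔
      y ∈ forwardOrbit f x) ∧
    (∀ x y : X, etaOrderType.{u} ∈ emergentOrderSpectrum f x y) := by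
  obtain ⟨x₀, -⟩ := id hf
  have hgen := residual_prod_generic hiso hf
  have : Nonempty (X × X) := ⟨(x₀, x₀)⟩
  obtain ⟨⟨x, y⟩, hx, hy, hxy⟩ := (dense_of_mem_residual hgen).nonempty
  have heta := etaOrderType_mem_emergentOrderSpectrum hiso hf
  refine ⟨fun L _ _ hL => ?_, Set.mem_iUnion.2 ⟨(x, y), heta x y⟩,
    ⟨_, hgen, fun x y hq L _ _ _ hL =>
      type_mem_emergentOrderSpectrum_of_isScattered hiso hf hq.1 hq.2.1 hq.2.2 L hL⟩,
    exists_finiteOrderType_mem_iff f, heta⟩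
  rcases finite_or_infinite L with hfin | hinf
  · have := Fintype.ofFinite L
    -- The orbit of `x` has no repetitions, so a segment with the right number of interior points
    -- realizes `L`.
    refine Set.mem_iUnion.2 ⟨(x, f^[Fintype.card L + 1] x), ?_⟩
    refine type_mem_emergentOrderSpectrum_iterate (fun i j hij _ h => ?_) L rfl
    rw [iterate_eq_zpow, iterate_eq_zpow f j] at h
    exact absurd (Int.ofNat_inj.1 (hx.zpow_ne hiso h)) hij.ne
  · exact Set.mem_iUnion.2 ⟨(x, y),
      type_mem_emergentOrderSpectrum_of_isScattered hiso hf hx hy hxy L hL⟩
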